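/- Fix a dimension $d$. For each sample size $n$ let $v_1,\dots,v_n$ (which may depend on $n$, as a triangular array, and may live on a probability space depending on $n$) be independent random vectors in $\mathbb{R}^d$ with mean zero and with fourth moments bounded uniformly: there is $C<\infty$ such that $E[v_{il}^4]\le C$ for all $n$, all $i=1,\dots,n$ and all coordinates $l=1,\dots,d$. Let $s_1,\dots,s_n\in\mathbb{R}^d$ be nonstochastic vectors, $G=(G_{ij})$ a nonstochastic real $n\times n$ matrix (not required to be symmetric), and $A$ a nonstochastic real $d\times d$ matrix; $s_i$, $G$ and $A$ may depend on $n$, the entries of $A$ being bounded uniformly in $n$ (for instance, $A$ fixed). Put \[ T=\sum_{i=1}^n s_i'v_i+\sum_{i=1}^n\sum_{j\ne i}G_{ij}\,v_i'Av_j . \] Suppose that, as $n\to\infty$, 1. $\mathrm{Var}(T)^{-1/2}$ is bounded, that is, for some $C<\infty$ one has $\mathrm{Var}(T)>0$ and $\mathrm{Var}(T)^{-1/2}\le C$ for all sufficiently large $n$; 2. $\sum_{i=1}^n s_{il}^4\to0$ for every $l=1,\dots,d$; and 3. $\|G_LG_L'\|_F+\|G_UG_U'\|_F\to0$, where $G_L$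 and $G_U$ are the strictly lower- and strictly upper-triangular parts of $G$, with elements $G_{L,ij}=G_{ij}1\{i>j\}$ and $G_{U,ij}=G_{ij}1\{i<j\}$, and $\|\cdot\|_F$ is the Frobenius norm. Then $\mathrm{Var}(T)^{-1/2}\,T\xrightarrow{d}N(0,1)$ as $n\to\infty$. -/

import Mathlib

open MeasureTheory ProbabilityTheory Filter Topology
open scoped Matrix

/- The norm on real matrices is the Frobenius norm. -/
attribute [local instance] Matrix.frobeniusNormedAddCommGroup

/-- The strictly lower-triangular part `G_L` of `G`: the entries `G i j` with `i > j`. -/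
def strictLower {n : ℕ} (G : Matrix (Fin n) (Fin n) ℝ) : Matrix (Fin n) (Fin n) ℝ :=
  Matrix.of fun i j => if i > j then G i j else 0

/-- The strictly upper-triangular part `G_U` of `G`: the entries `G i j` with `i < j`. -/
def strictUpper {n : ℕ} (G : Matrix (Fin n) (Fin n) ℝ) : Matrix (Fin n) (Fin n) ℝ :=
  Matrix.of fun i j => if i < j then G i j else 0

/-- The random variable `T = ∑ i, sᵢ' vᵢ + ∑ i, ∑ j ≠ i, G i j * vᵢ' A vⱼ`. -/
def quadraticStat {Ω : Type*} {n d : ℕ} (s : Fin n → Fin d → ℝ)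
    (G : Matrix (Fin n) (Fin n) ℝ) (A : Matrix (Fin d) (Fin d) ℝ)
    (v : Fin n → Ω → Fin d → ℝ) (ω : Ω) : ℝ :=
  (∑ i, s i ⬝ᵥ v i ω) +
    ∑ i, ∑ j ∈ Finset.univ.filter (fun j => j ≠ i), G i j * (v i ω ⬝ᵥ (A *ᵥ v j ω))

/-
Listing each pair of indices with the larger one first turns `T` into a sum of martingale
differences `X k = w k ⬝ᵥ v k`, whose weight `w k` is an affine function of the earlier vectors.
The conditional variances of the `X k` sum to a constant plus a linear form plus a quadratic form in
independent vectors, and `‖G_L G_Lᵀ‖ + ‖G_U G_Uᵀ‖ → 0` makes the variance of both forms vanish. It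
also makes `∑ k, (∑ j < k, (G k j ^ 2 + G j k ^ 2)) ^ 2` vanish, and together with
`∑ i, s i l ^ 4 → 0` this makes the sum of the fourth moments of the `X k` vanish. The martingale
central limit theorem then applies. With `S` and `V` the partial sums of `X` and of the conditional
variances, `exp (i t S + t² V / 2)` is almost a martingale as long as `V` is bounded, which stopping
ensures; so the characteristic function of `S` is close to `exp (-t² / 2)`.
-/

section Inequalities

lemma exp_half_le_two : Real.exp (1 / 2) ≤ 2 :=
  (Real.exp_bound_div_one_sub_of_interval (by norm_num) (by norm_num)).trans (by norm_num)

lemma norm_exp_mul_I_sub_taylor_le (x : ℝ) :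
    ‖Complex.exp (x * Complex.I) - (1 + x * Complex.I - x ^ 2 / 2)‖ ≤ 4 * |x| ^ 3 := by
  rcases le_or_gt |x| 1 with hx | hx
  · have taylor := Complex.norm_exp_sub_sum_le_norm_mul_exp (x * Complex.I) 3
    have partialSum : ∑ j ∈ Finset.range 3, (x * Complex.I) ^ j / (j.factorial : ℂ) =
        1 + x * Complex.I - x ^ 2 / 2 := by
      simp only [Finset.sum_range_succ, Finset.sum_range_zero, mul_pow, Complex.I_sq,
        Nat.factorial]
      push_cast
      ring
    rw [partialSum] at taylor
    calc _ ≤ |x| ^ 3 * Real.exp |x| := by simpa using taylor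
      _ ≤ |x| ^ 3 * Real.exp 1 := by gcongr
      _ ≤ 4 * |x| ^ 3 := by nlinarith [Real.exp_one_lt_d9, pow_nonneg (abs_nonneg x) 3]
  · calc _ ≤ ‖Complex.exp (x * Complex.I)‖ + (‖(1 : ℂ)‖ + ‖x * Complex.I‖ + ‖(x : ℂ) ^ 2 / 2‖) :=
          (norm_sub_le _ _).trans (by gcongr; exact (norm_sub_le _ _).trans (by
            gcongr; exact norm_add_le _ _))
      _ = 2 + |x| + |x| ^ 2 / 2 := by
          rw [Complex.norm_exp_ofReal_mul_I]
          simp only [norm_one, norm_mul, Complex.norm_real, Real.norm_eq_abs, Complex.norm_I,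
            mul_one, norm_div, norm_pow, Complex.norm_ofNat]
          ring
      _ ≤ 4 * |x| ^ 3 := by nlinarith [pow_le_pow_right₀ hx.le (show 2 ≤ 3 by norm_num)]

lemma abs_exp_mul_one_sub_sub_one_le {a : ℝ} (ha : 0 ≤ a) :
    |Real.exp a * (1 - a) - 1| ≤ Real.exp a * a ^ 2 := by
  have lower : 1 - a ≤ Real.exp (-a) := Real.one_sub_le_exp_neg a
  have upper : Real.exp (-a) ≤ 1 - a + a ^ 2 := by
    calc Real.exp (-a) = (Real.exp a)⁻¹ := Real.exp_neg a
      _ ≤ (a + 1)⁻¹ := by gcongr; exact Real.add_one_le_exp a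
      _ ≤ 1 - a + a ^ 2 := by
        rw [inv_le_iff_one_le_mul₀ (by positivity)]
        nlinarith [pow_nonneg ha 3]
  have cancel : Real.exp a * Real.exp (-a) = 1 := by
    rw [← Real.exp_add, add_neg_cancel, Real.exp_zero]
  rw [abs_le]
  constructor <;> nlinarith [Real.exp_pos a]

lemma abs_one_sub_exp_le {y b : ℝ} (hy : y ≤ b) (hb : 0 ≤ b) :
    |1 - Real.exp y| ≤ Real.exp b * |y| := by
  have one_le : 1 ≤ Real.exp b := Real.one_le_exp hb
  have tangent : y + 1 ≤ Real.exp y := Real.add_one_le_exp y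
  rcases le_total 0 y with h0 | h0
  · have secant : Real.exp y * (1 - y) ≤ 1 := by
      calc Real.exp y * (1 - y) ≤ Real.exp y * Real.exp (-y) := by
            gcongr; exact Real.one_sub_le_exp_neg y
        _ = 1 := by rw [← Real.exp_add, add_neg_cancel, Real.exp_zero]
    rw [abs_of_nonneg h0, abs_of_nonpos (by linarith)]
    nlinarith [Real.exp_le_exp.2 hy]
  · rw [abs_of_nonpos h0, abs_of_nonneg (by linarith [Real.exp_le_one_iff.2 h0])]
    nlinarith

lemma norm_compensated_exp_sub_le (x : ℝ) {q : ℝ} (hq : 0 ≤ q) :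
    ‖(Real.exp (q / 2) : ℂ) * Complex.exp (x * Complex.I) - 1 -
        Real.exp (q / 2) * (x * Complex.I + (q - x ^ 2) / 2)‖ ≤
      Real.exp (q / 2) * (q ^ 2 + 4 * |x| ^ 3) := by
  set e := Real.exp (q / 2)
  calc _ = ‖((e * (1 - q / 2) - 1 : ℝ) : ℂ) +
          e * (Complex.exp (x * Complex.I) - (1 + x * Complex.I - x ^ 2 / 2))‖ := by
        congr 1
        push_cast
        ring
    _ ≤ |e * (1 - q / 2) - 1| +
          e * ‖Complex.exp (x * Complex.I) - (1 + x * Complex.I - x ^ 2 / 2)‖ := by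
        refine (norm_add_le _ _).trans_eq ?_
        rw [norm_mul, Complex.norm_real, Complex.norm_real, Real.norm_eq_abs,
          Real.norm_of_nonneg (Real.exp_pos _).le]
    _ ≤ e * (q / 2) ^ 2 + e * (4 * |x| ^ 3) := by
        gcongr
        · exact abs_exp_mul_one_sub_sub_one_le (by positivity)
        · exact norm_exp_mul_I_sub_taylor_le x
    _ ≤ e * (q ^ 2 + 4 * |x| ^ 3) := by
        nlinarith [mul_nonneg (Real.exp_pos (q / 2)).le (sq_nonneg q)]

end Inequalities

section CauchySchwarz

variable {Ω : Type*} {m : MeasurableSpace Ω} {μ : Measure Ω} {f g : Ω → ℝ}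

lemma integral_abs_mul_le_sqrt (hf : MemLp f 2 μ) (hg : MemLp g 2 μ) :
    ∫ ω, |f ω * g ω| ∂μ ≤ √(∫ ω, f ω ^ 2 ∂μ) * √(∫ ω, g ω ^ 2 ∂μ) := by
  have holder := integral_mul_norm_le_Lp_mul_Lq (f := f) (g := g) Real.HolderConjugate.two_two
    (by simpa using hf) (by simpa using hg)
  simpa only [Real.norm_eq_abs, ← abs_mul, Real.rpow_two, sq_abs, ← Real.sqrt_eq_rpow]
    using holder

lemma sq_integral_mul_le (hf : MemLp f 2 μ) (hg : MemLp g 2 μ) :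
    (∫ ω, f ω * g ω ∂μ) ^ 2 ≤ (∫ ω, f ω ^ 2 ∂μ) * ∫ ω, g ω ^ 2 ∂μ := by
  calc (∫ ω, f ω * g ω ∂μ) ^ 2 = |∫ ω, f ω * g ω ∂μ| ^ 2 := (sq_abs _).symm
    _ ≤ (√(∫ ω, f ω ^ 2 ∂μ) * √(∫ ω, g ω ^ 2 ∂μ)) ^ 2 := by
        gcongr
        exact abs_integral_le_integral_abs.trans (integral_abs_mul_le_sqrt hf hg)
    _ = (∫ ω, f ω ^ 2 ∂μ) * ∫ ω, g ω ^ 2 ∂μ := by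
        rw [mul_pow, Real.sq_sqrt (integral_nonneg fun ω => sq_nonneg (f ω)),
          Real.sq_sqrt (integral_nonneg fun ω => sq_nonneg (g ω))]

lemma integral_abs_le_sqrt [IsProbabilityMeasure μ] (hf : MemLp f 2 μ) :
    ∫ ω, |f ω| ∂μ ≤ √(∫ ω, f ω ^ 2 ∂μ) := by
  simpa using integral_abs_mul_le_sqrt hf (memLp_const (μ := μ) (p := 2) (1 : ℝ))

lemma memLp_four_iff_integrable_pow (hf : AEStronglyMeasurable f μ) :
    MemLp f 4 μ ↔ Integrable (fun ω => f ω ^ 4) μ := by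
  rw [← integrable_norm_rpow_iff hf (by norm_num) (by norm_num)]
  have norm_pow : ∀ ω, ‖f ω‖ ^ (4 : ENNReal).toReal = f ω ^ 4 := fun ω => by
    rw [ENNReal.toReal_ofNat, Real.rpow_ofNat, Real.norm_eq_abs, Even.pow_abs (by decide)]
  simp only [norm_pow]

lemma memLp_two_mul_of_memLp_four (hf : MemLp f 4 μ) (hg : MemLp g 4 μ) :
    MemLp (fun ω => f ω * g ω) 2 μ := by
  have : ENNReal.HolderTriple 4 4 2 := ⟨by
    rw [← ENNReal.toReal_eq_toReal_iff' (by simp) (by simp),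
      ENNReal.toReal_add (by simp) (by simp)]
    norm_num⟩
  exact hg.mul' hf

lemma memLp_two_sq_of_memLp_four (hf : MemLp f 4 μ) : MemLp (fun ω => f ω ^ 2) 2 μ := by
  simpa only [sq] using memLp_two_mul_of_memLp_four hf hf

lemma integral_sq_le_of_integral_pow_four_le [IsProbabilityMeasure μ] (hf : MemLp f 4 μ) {κ : ℝ}
    (hκ : 0 ≤ κ) (h : ∫ ω, f ω ^ 4 ∂μ ≤ κ ^ 2) : ∫ ω, f ω ^ 2 ∂μ ≤ κ := by
  refine le_of_sq_le_sq ?_ hκ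
  calc (∫ ω, f ω ^ 2 ∂μ) ^ 2 ≤ ∫ ω, (f ω ^ 2) ^ 2 ∂μ := by
        simpa using sq_integral_mul_le (memLp_two_sq_of_memLp_four hf)
          (memLp_const (μ := μ) (p := 2) (1 : ℝ))
    _ ≤ κ ^ 2 := by simpa only [← pow_mul] using h

lemma integral_mul_sq_le_of_integral_pow_four_le (hf : MemLp f 4 μ) (hg : MemLp g 4 μ) {κ : ℝ}
    (hfκ : ∫ ω, f ω ^ 4 ∂μ ≤ κ ^ 2) (hgκ : ∫ ω, g ω ^ 4 ∂μ ≤ κ ^ 2) :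
    ∫ ω, (f ω * g ω) ^ 2 ∂μ ≤ κ ^ 2 := by
  refine le_of_sq_le_sq ?_ (sq_nonneg κ)
  calc (∫ ω, (f ω * g ω) ^ 2 ∂μ) ^ 2 ≤ (∫ ω, f ω ^ 4 ∂μ) * ∫ ω, g ω ^ 4 ∂μ := by
        simpa only [mul_pow, ← pow_mul] using
          sq_integral_mul_le (memLp_two_sq_of_memLp_four hf) (memLp_two_sq_of_memLp_four hg)
    _ ≤ κ ^ 2 * κ ^ 2 := by gcongr
    _ = (κ ^ 2) ^ 2 := (sq _).symm

lemma integral_abs_pow_three_le_sqrt [IsFiniteMeasure μ] (hf : MemLp f 4 μ) :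
    ∫ ω, |f ω| ^ 3 ∂μ ≤ √(∫ ω, f ω ^ 2 ∂μ) * √(∫ ω, f ω ^ 4 ∂μ) := by
  simpa only [← pow_succ', abs_pow, ← pow_mul] using
    integral_abs_mul_le_sqrt (hf.mono_exponent (by norm_num)) (memLp_two_sq_of_memLp_four hf)

end CauchySchwarz

section MartingaleDifferences

variable {Ω : Type*} {m : MeasurableSpace Ω} {μ : Measure Ω}

lemma integral_condExp_smul {E : Type*} [NormedAddCommGroup E] [NormedSpace ℝ E] [CompleteSpace E]
    {m₀ : MeasurableSpace Ω} (hm : m₀ ≤ m) [SigmaFinite (μ.trim hm)] {f : Ω → ℝ} {Y : Ω → E}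
    (hY : StronglyMeasurable[m₀] Y) (hf : Integrable f μ)
    (hfY : Integrable (fun ω => f ω • Y ω) μ) :
    ∫ ω, (μ[f | m₀]) ω • Y ω ∂μ = ∫ ω, f ω • Y ω ∂μ := by
  rw [← integral_condExp hm (f := fun ω => f ω • Y ω)]
  exact integral_congr_ae
    (condExp_bilin_of_stronglyMeasurable_right (.lsmul ℝ ℝ) hY hfY hf).symm

lemma integrable_exp_mul_I [IsFiniteMeasure μ] {f : Ω → ℝ} (hf : AEStronglyMeasurable f μ) :
    Integrable (fun ω => Complex.exp (f ω * Complex.I)) μ :=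
  (integrable_const (1 : ℝ)).mono' (by fun_prop)
    (ae_of_all _ fun ω => (Complex.norm_exp_ofReal_mul_I (f ω)).le)

/-- `X` is a sequence of martingale differences for the filtration `F`, with finite fourth moments
and conditional variances `q`: `X k` is revealed at time `k + 1`, and `q k` is a version of
`E[X k ^ 2 | F k]` that is nonnegative everywhere. -/
structure IsMartingaleDifference (μ : Measure Ω) (F : Filtration ℕ m) (X q : ℕ → Ω → ℝ) :
    Prop where
  stronglyMeasurable_diff : ∀ k, StronglyMeasurable[F (k + 1)] (X k)
  stronglyMeasurable_condVar : ∀ k, StronglyMeasurable[F k] (q k)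
  memLp_four : ∀ k, MemLp (X k) 4 μ
  condVar_nonneg : ∀ k ω, 0 ≤ q k ω
  condExp_diff : ∀ k, μ[X k | F k] =ᵐ[μ] 0
  condExp_sq : ∀ k, μ[fun ω => X k ω ^ 2 | F k] =ᵐ[μ] q k

/-- The set of outcomes for which the conditional variances up to and including time `k` sum to at
most `c`; it is known at time `k`. -/
def condVarSumLE (q : ℕ → Ω → ℝ) (c : ℝ) (k : ℕ) : Set Ω :=
  {ω | ∑ j ∈ Finset.range (k + 1), q j ω ≤ c}

/-- The exponential `exp (i S n + V n / 2)`, where `S` and `V` are the partial sums of `X` and of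
`q`. When `X` are martingale differences with conditional variances `q` it is almost a
martingale. -/
noncomputable def compensatedExp (X q : ℕ → Ω → ℝ) (n : ℕ) (ω : Ω) : ℂ :=
  Real.exp ((∑ k ∈ Finset.range n, q k ω) / 2) *
    Complex.exp ((∑ k ∈ Finset.range n, X k ω : ℝ) * Complex.I)

lemma compensatedExp_succ (X q : ℕ → Ω → ℝ) (n : ℕ) (ω : Ω) :
    compensatedExp X q (n + 1) ω =
      compensatedExp X q n ω * (Real.exp (q n ω / 2) * Complex.exp (X n ω * Complex.I)) := by
  simp only [compensatedExp, Finset.sum_range_succ, add_div, Real.exp_add, Complex.ofReal_mul,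
    Complex.ofReal_add, add_mul, Complex.exp_add]
  ring

lemma norm_compensatedExp (X q : ℕ → Ω → ℝ) (n : ℕ) (ω : Ω) :
    ‖compensatedExp X q n ω‖ = Real.exp ((∑ k ∈ Finset.range n, q k ω) / 2) := by
  rw [compensatedExp, norm_mul, Complex.norm_exp_ofReal_mul_I, mul_one, Complex.norm_real,
    Real.norm_of_nonneg (Real.exp_pos _).le]

lemma norm_compensatedExp_mul_exp (X q : ℕ → Ω → ℝ) (n : ℕ) (ω : Ω) :
    ‖compensatedExp X q n ω‖ * Real.exp (q n ω / 2) =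
      Real.exp ((∑ k ∈ Finset.range (n + 1), q k ω) / 2) := by
  rw [norm_compensatedExp, ← Real.exp_add, ← add_div, Finset.sum_range_succ]

lemma norm_compensatedExp_succ_sub_le (X : ℕ → Ω → ℝ) {q : ℕ → Ω → ℝ} (k : ℕ) {ω : Ω}
    (hq : 0 ≤ q k ω) :
    ‖compensatedExp X q (k + 1) ω - compensatedExp X q k ω -
        compensatedExp X q k ω * Real.exp (q k ω / 2) *
          (X k ω * Complex.I + (q k ω - X k ω ^ 2) / 2)‖ ≤
      Real.exp ((∑ j ∈ Finset.range (k + 1), q j ω) / 2) * (q k ω ^ 2 + 4 * |X k ω| ^ 3) := by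
  rw [← norm_compensatedExp_mul_exp X, compensatedExp_succ, ← mul_sub_one, mul_assoc, ← mul_sub,
    norm_mul, mul_assoc]
  gcongr
  exact norm_compensated_exp_sub_le (X k ω) hq

namespace IsMartingaleDifference

variable {F : Filtration ℕ m} {X q : ℕ → Ω → ℝ}

lemma stronglyMeasurable (h : IsMartingaleDifference μ F X q) {j k : ℕ} (hjk : j < k) :
    StronglyMeasurable[F k] (X j) :=
  (h.stronglyMeasurable_diff j).mono (F.mono hjk)

lemma stronglyMeasurable_sum_condVar (h : IsMartingaleDifference μ F X q) (k : ℕ) :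
    StronglyMeasurable[F k] fun ω => ∑ j ∈ Finset.range (k + 1), q j ω :=
  Finset.stronglyMeasurable_fun_sum _ fun j hj =>
    (h.stronglyMeasurable_condVar j).mono (F.mono (Nat.lt_succ_iff.1 (Finset.mem_range.1 hj)))

lemma measurableSet_condVarSumLE (h : IsMartingaleDifference μ F X q) (c : ℝ) (k : ℕ) :
    MeasurableSet[F k] (condVarSumLE q c k) :=
  (h.stronglyMeasurable_sum_condVar k).measurable measurableSet_Iic

lemma stronglyMeasurable_compensatedExp (h : IsMartingaleDifference μ F X q) (k : ℕ) :
    StronglyMeasurable[F k] (compensatedExp X q k) := by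
  have hS : StronglyMeasurable[F k] fun ω => ∑ j ∈ Finset.range k, X j ω :=
    Finset.stronglyMeasurable_fun_sum _ fun j hj => h.stronglyMeasurable (Finset.mem_range.1 hj)
  have hV : StronglyMeasurable[F k] fun ω => ∑ j ∈ Finset.range k, q j ω :=
    Finset.stronglyMeasurable_fun_sum _ fun j hj =>
      (h.stronglyMeasurable_condVar j).mono (F.mono (Finset.mem_range.1 hj).le)
  exact ((by fun_prop : Continuous fun x : ℝ => (Real.exp (x / 2) : ℂ)).comp_stronglyMeasurable
    hV).mul ((by fun_prop : Continuous fun x : ℝ =>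
      Complex.exp (x * Complex.I)).comp_stronglyMeasurable hS)

lemma const_mul (h : IsMartingaleDifference μ F X q) (a : ℝ) :
    IsMartingaleDifference μ F (fun k ω => a * X k ω) (fun k ω => a ^ 2 * q k ω) where
  stronglyMeasurable_diff k := (h.stronglyMeasurable_diff k).const_mul a
  stronglyMeasurable_condVar k := (h.stronglyMeasurable_condVar k).const_mul _
  memLp_four k := (h.memLp_four k).const_mul a
  condVar_nonneg k ω := mul_nonneg (sq_nonneg a) (h.condVar_nonneg k ω)
  condExp_diff k := by
    filter_upwards [condExp_smul (μ := μ) a (X k) (F k), h.condExp_diff k] with ω hsmul hX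
    exact hsmul.trans (by simp [hX])
  condExp_sq k := by
    simp only [mul_pow]
    filter_upwards [condExp_smul (μ := μ) (a ^ 2) (fun ω => X k ω ^ 2) (F k), h.condExp_sq k]
      with ω hsmul hX
    exact hsmul.trans (by simp [hX])

lemma sum_condVar_le_of_le (h : IsMartingaleDifference μ F X q) {j k : ℕ} (hjk : j ≤ k) (ω : Ω) :
    ∑ i ∈ Finset.range j, q i ω ≤ ∑ i ∈ Finset.range k, q i ω :=
  Finset.sum_le_sum_of_subset_of_nonneg (Finset.range_subset_range.2 hjk)
    fun i _ _ => h.condVar_nonneg i ω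

lemma sum_stopped_condVar_le (h : IsMartingaleDifference μ F X q) {c : ℝ} (hc : 0 ≤ c) (n : ℕ)
    (ω : Ω) : ∑ k ∈ Finset.range n, (condVarSumLE q c k).indicator (q k) ω ≤ c := by
  induction n with
  | zero => simpa using hc
  | succ n ih =>
    by_cases hω : ω ∈ condVarSumLE q c n
    · exact (Finset.sum_le_sum fun k _ =>
        Set.indicator_le_self' (fun ω _ => h.condVar_nonneg k ω) ω).trans hω
    · rwa [Finset.sum_range_succ, Set.indicator_of_notMem hω, add_zero]

lemma sum_stopped_eq (h : IsMartingaleDifference μ F X q) {c : ℝ} {n : ℕ} {ω : Ω}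
    (hω : ∑ k ∈ Finset.range n, q k ω ≤ c) (f : ℕ → Ω → ℝ) :
    ∑ k ∈ Finset.range n, (condVarSumLE q c k).indicator (f k) ω =
      ∑ k ∈ Finset.range n, f k ω :=
  Finset.sum_congr rfl fun k hk => Set.indicator_of_mem (s := condVarSumLE q c k)
    ((h.sum_condVar_le_of_le (Finset.mem_range.1 hk) ω).trans hω) _

lemma norm_charFn_sub_compensatedExp_stopped_le (h : IsMartingaleDifference μ F X q) {v : ℝ}
    (hv : 0 ≤ v) (n : ℕ) (ω : Ω) :
    ‖Complex.exp ((∑ k ∈ Finset.range n, X k ω : ℝ) * Complex.I) - Real.exp (-v / 2) *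
        compensatedExp (fun k => (condVarSumLE q (v + 1) k).indicator (X k))
          (fun k => (condVarSumLE q (v + 1) k).indicator (q k)) n ω‖ ≤
      3 * |∑ k ∈ Finset.range n, q k ω - v| := by
  rcases le_or_gt (∑ k ∈ Finset.range n, q k ω) (v + 1) with hω | hω
  · simp only [compensatedExp, h.sum_stopped_eq hω]
    set V := ∑ k ∈ Finset.range n, q k ω
    set S := ∑ k ∈ Finset.range n, X k ω
    calc _ = ‖((1 - Real.exp ((V - v) / 2) : ℝ) : ℂ) * Complex.exp (S * Complex.I)‖ := by
          rw [← mul_assoc, ← Complex.ofReal_mul, ← Real.exp_add, ← add_div, neg_add_eq_sub,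
            Complex.ofReal_sub, Complex.ofReal_one, sub_mul, one_mul]
      _ = |1 - Real.exp ((V - v) / 2)| := by
          rw [norm_mul, Complex.norm_exp_ofReal_mul_I, mul_one, Complex.norm_real, Real.norm_eq_abs]
      _ ≤ Real.exp (1 / 2) * |(V - v) / 2| := abs_one_sub_exp_le (by linarith) (by norm_num)
      _ ≤ 3 * |V - v| := by
          rw [abs_div, abs_two]
          nlinarith [abs_nonneg (V - v), exp_half_le_two]
  · have far : 1 < |∑ k ∈ Finset.range n, q k ω - v| := lt_abs.2 (Or.inl (by linarith))
    refine (norm_sub_le _ _).trans ?_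
    rw [Complex.norm_exp_ofReal_mul_I, norm_mul, Complex.norm_real, norm_compensatedExp,
      Real.norm_of_nonneg (Real.exp_pos _).le, ← Real.exp_add, ← add_div]
    have stopped_le : Real.exp ((-v +
        ∑ k ∈ Finset.range n, (condVarSumLE q (v + 1) k).indicator (q k) ω) / 2) ≤ 2 :=
      (Real.exp_le_exp.2 (by
        linarith [h.sum_stopped_condVar_le (by positivity : 0 ≤ v + 1) n ω])).trans exp_half_le_two
    linarith

lemma integrable_condVar (h : IsMartingaleDifference μ F X q) (k : ℕ) : Integrable (q k) μ :=
  integrable_condExp.congr (h.condExp_sq k)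

lemma integral_stopped_pow_four_le (h : IsMartingaleDifference μ F X q) (c : ℝ) (k : ℕ) :
    ∫ ω, (condVarSumLE q c k).indicator (X k) ω ^ 4 ∂μ ≤ ∫ ω, X k ω ^ 4 ∂μ := by
  refine integral_mono_of_nonneg (ae_of_all _ fun ω => by positivity)
    ((memLp_four_iff_integrable_pow (h.memLp_four k).1).1 (h.memLp_four k))
    (ae_of_all _ fun ω => ?_)
  by_cases hω : ω ∈ condVarSumLE q c k
  · simp only [Set.indicator_of_mem hω, le_refl]
  · simp only [Set.indicator_of_notMem hω, zero_pow four_ne_zero]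
    positivity

lemma memLp_two_condVar (h : IsMartingaleDifference μ F X q) (k : ℕ) : MemLp (q k) 2 μ :=
  ((memLp_two_sq_of_memLp_four (h.memLp_four k)).condExp one_le_two).ae_eq (h.condExp_sq k)

variable [IsProbabilityMeasure μ]

lemma memLp_two (h : IsMartingaleDifference μ F X q) (k : ℕ) : MemLp (X k) 2 μ :=
  (h.memLp_four k).mono_exponent (by norm_num)

lemma integrable_diff (h : IsMartingaleDifference μ F X q) (k : ℕ) : Integrable (X k) μ :=
  (h.memLp_two k).integrable one_le_two

lemma memLp_two_sum (h : IsMartingaleDifference μ F X q) (n : ℕ) :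
    MemLp (fun ω => ∑ k ∈ Finset.range n, X k ω) 2 μ :=
  memLp_finsetSum _ fun k _ => h.memLp_two k

lemma integral_sum_eq_zero (h : IsMartingaleDifference μ F X q) (n : ℕ) :
    ∫ ω, ∑ k ∈ Finset.range n, X k ω ∂μ = 0 := by
  rw [integral_finsetSum _ fun k _ => h.integrable_diff k]
  refine Finset.sum_eq_zero fun k _ => ?_
  rw [← integral_condExp (F.le k), integral_congr_ae (h.condExp_diff k), Pi.zero_def,
    integral_zero]

lemma integral_sq (h : IsMartingaleDifference μ F X q) (k : ℕ) :
    ∫ ω, X k ω ^ 2 ∂μ = ∫ ω, q k ω ∂μ := by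
  rw [← integral_condExp (F.le k), integral_congr_ae (h.condExp_sq k)]

lemma integral_sum_mul_eq_zero (h : IsMartingaleDifference μ F X q) (n : ℕ) :
    ∫ ω, X n ω * ∑ k ∈ Finset.range n, X k ω ∂μ = 0 := by
  refine (integral_condExp_smul (F.le n) (Finset.stronglyMeasurable_fun_sum _ fun k hk =>
    h.stronglyMeasurable (Finset.mem_range.1 hk)) (h.integrable_diff n)
    ((h.memLp_two n).integrable_mul (h.memLp_two_sum n))).symm.trans ?_
  exact integral_eq_zero_of_ae ((h.condExp_diff n).mono fun ω hω => by simp [hω])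

lemma variance_sum_eq (h : IsMartingaleDifference μ F X q) (n : ℕ) :
    Var[fun ω => ∑ k ∈ Finset.range n, X k ω; μ] = ∫ ω, ∑ k ∈ Finset.range n, q k ω ∂μ := by
  rw [variance_of_integral_eq_zero (h.memLp_two_sum n).1.aemeasurable (h.integral_sum_eq_zero n),
    integral_finsetSum _ fun k _ => h.integrable_condVar k]
  induction n with
  | zero => simp
  | succ n ih =>
    have cross : Integrable (fun ω => X n ω * ∑ k ∈ Finset.range n, X k ω) μ :=
      (h.memLp_two n).integrable_mul (h.memLp_two_sum n)
    calc ∫ ω, (∑ k ∈ Finset.range (n + 1), X k ω) ^ 2 ∂μ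
        = ∫ ω, ((∑ k ∈ Finset.range n, X k ω) ^ 2 +
            2 * (X n ω * ∑ k ∈ Finset.range n, X k ω)) + X n ω ^ 2 ∂μ := by
          congr 1 with ω
          rw [Finset.sum_range_succ]
          ring
      _ = _ := by
          rw [integral_add ((h.memLp_two_sum n).integrable_sq.fun_add (cross.const_mul 2))
              (h.memLp_two n).integrable_sq,
            integral_add (h.memLp_two_sum n).integrable_sq (cross.const_mul 2), integral_const_mul,
            h.integral_sum_mul_eq_zero, ih, h.integral_sq, mul_zero, add_zero,
            Finset.sum_range_succ]

lemma stopped (h : IsMartingaleDifference μ F X q) (c : ℝ) :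
    IsMartingaleDifference μ F (fun k => (condVarSumLE q c k).indicator (X k))
      (fun k => (condVarSumLE q c k).indicator (q k)) where
  stronglyMeasurable_diff k := (h.stronglyMeasurable_diff k).indicator
    (F.mono (Nat.le_succ k) _ (h.measurableSet_condVarSumLE c k))
  stronglyMeasurable_condVar k :=
    (h.stronglyMeasurable_condVar k).indicator (h.measurableSet_condVarSumLE c k)
  memLp_four k := (h.memLp_four k).indicator (F.le k _ (h.measurableSet_condVarSumLE c k))
  condVar_nonneg k ω := Set.indicator_nonneg (fun ω _ => h.condVar_nonneg k ω) ω
  condExp_diff k := by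
    simpa only [Set.indicator_zero'] using (condExp_indicator (h.integrable_diff k)
      (h.measurableSet_condVarSumLE c k)).trans (h.condExp_diff k).indicator
  condExp_sq k := by
    have sq_indicator : (fun ω => (condVarSumLE q c k).indicator (X k) ω ^ 2) =
        (condVarSumLE q c k).indicator fun ω => X k ω ^ 2 :=
      (Set.indicator_comp_of_zero (g := fun x : ℝ => x ^ 2) (zero_pow two_ne_zero)).symm
    rw [sq_indicator]
    exact (condExp_indicator (h.memLp_two k).integrable_sq
      (h.measurableSet_condVarSumLE c k)).trans (h.condExp_sq k).indicator

lemma integral_condVar_sq_le (h : IsMartingaleDifference μ F X q) (k : ℕ) :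
    ∫ ω, q k ω ^ 2 ∂μ ≤ ∫ ω, X k ω ^ 4 ∂μ := by
  have hq := h.memLp_two_condVar k
  have hX := memLp_two_sq_of_memLp_four (h.memLp_four k)
  have pull_out : ∫ ω, X k ω ^ 2 * q k ω ∂μ = ∫ ω, q k ω ^ 2 ∂μ := by
    refine (integral_condExp_smul (F.le k) (h.stronglyMeasurable_condVar k)
      (hX.integrable one_le_two) (hX.integrable_mul hq)).symm.trans ?_
    refine integral_congr_ae ((h.condExp_sq k).mono fun ω hω => ?_)
    simp only [hω, smul_eq_mul, ← sq]
  have nonneg : 0 ≤ ∫ ω, q k ω ^ 2 ∂μ := integral_nonneg fun ω => sq_nonneg _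
  have cauchy_schwarz := sq_integral_mul_le hX hq
  simp only [pull_out, ← pow_mul] at cauchy_schwarz
  rcases nonneg.eq_or_lt with h0 | h0
  · exact h0.symm.trans_le (integral_nonneg fun ω => by positivity)
  · exact le_of_mul_le_mul_right (by rwa [← sq]) h0

lemma integral_mul_eq_zero (h : IsMartingaleDifference μ F X q) (k : ℕ) {Y : Ω → ℂ}
    (hY : StronglyMeasurable[F k] Y) {C : ℝ} (hC : ∀ ω, ‖Y ω‖ ≤ C) :
    ∫ ω, Y ω * (X k ω * Complex.I + (q k ω - X k ω ^ 2) / 2) ∂μ = 0 := by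
  have hYm : AEStronglyMeasurable Y μ := (hY.mono (F.le k)).aestronglyMeasurable
  have test {f g : Ω → ℝ} (hf : Integrable f μ) (hfg : μ[f | F k] =ᵐ[μ] g) :
      Integrable (fun ω => f ω • Y ω) μ ∧ ∫ ω, f ω • Y ω ∂μ = ∫ ω, g ω • Y ω ∂μ := by
    have hfY : Integrable (fun ω => f ω • Y ω) μ := hf.smul_bdd C hYm (ae_of_all _ hC)
    refine ⟨hfY, ?_⟩
    rw [← integral_condExp_smul (F.le k) hY hf hfY]
    exact integral_congr_ae (hfg.mono fun ω hω => by simp only [hω])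
  obtain ⟨iX, eX⟩ := test (h.integrable_diff k) (h.condExp_diff k)
  obtain ⟨iX2, eX2⟩ := test (h.memLp_two k).integrable_sq (h.condExp_sq k)
  obtain ⟨iq, -⟩ := test (h.integrable_condVar k) EventuallyEq.rfl
  have iqX2 : Integrable (fun ω => (1 / 2 : ℂ) * (q k ω • Y ω - X k ω ^ 2 • Y ω)) μ :=
    (iq.sub iX2).const_mul _
  calc _ = ∫ ω, Complex.I * (X k ω • Y ω) +
          (1 / 2 : ℂ) * (q k ω • Y ω - X k ω ^ 2 • Y ω) ∂μ := by
        congr 1 with ω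
        simp only [Complex.real_smul]
        push_cast
        ring
    _ = 0 := by
        rw [integral_add (iX.const_mul _) iqX2, integral_const_mul, integral_const_mul,
          integral_sub iq iX2, eX, eX2, sub_self]
        simp

lemma integrable_mul (h : IsMartingaleDifference μ F X q) (k : ℕ) {Y : Ω → ℂ}
    (hY : StronglyMeasurable[F k] Y) {C : ℝ} (hC : ∀ ω, ‖Y ω‖ ≤ C) :
    Integrable (fun ω => Y ω * (X k ω * Complex.I + (q k ω - X k ω ^ 2) / 2)) μ := by
  have integrable_sq : Integrable (fun ω => (X k ω : ℂ) ^ 2) μ := by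
    simpa using (h.memLp_two k).integrable_sq.ofReal (𝕜 := ℂ)
  exact (((h.integrable_diff k).ofReal.mul_const _).add
    (((h.integrable_condVar k).ofReal.sub integrable_sq).div_const 2)).bdd_mul
      (hY.mono (F.le k)).aestronglyMeasurable (ae_of_all _ hC)

lemma integrable_compensatedExp (h : IsMartingaleDifference μ F X q) {n : ℕ} {c : ℝ}
    (hc : ∀ ω, ∑ k ∈ Finset.range n, q k ω ≤ c) : Integrable (compensatedExp X q n) μ := by
  refine (MemLp.of_bound (p := 1) ((h.stronglyMeasurable_compensatedExp n).mono
    (F.le n)).aestronglyMeasurable (Real.exp (c / 2)) (ae_of_all _ fun ω => ?_)).integrable le_rfl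
  rw [norm_compensatedExp]
  gcongr
  exact hc ω

lemma norm_integral_compensatedExp_succ_sub_le (h : IsMartingaleDifference μ F X q) {k : ℕ}
    {c : ℝ} (hc : ∀ ω, ∑ j ∈ Finset.range (k + 1), q j ω ≤ c) :
    ‖∫ ω, compensatedExp X q (k + 1) ω ∂μ - ∫ ω, compensatedExp X q k ω ∂μ‖ ≤
      Real.exp (c / 2) * (∫ ω, q k ω ^ 2 ∂μ + 4 * ∫ ω, |X k ω| ^ 3 ∂μ) := by
  set Y : Ω → ℂ := fun ω => compensatedExp X q k ω * Real.exp (q k ω / 2) with Y_def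
  have hY : StronglyMeasurable[F k] Y := (h.stronglyMeasurable_compensatedExp k).mul
    ((by fun_prop : Continuous fun x : ℝ => (Real.exp (x / 2) : ℂ)).comp_stronglyMeasurable
      (h.stronglyMeasurable_condVar k))
  have norm_Y (ω : Ω) : ‖Y ω‖ ≤ Real.exp (c / 2) := by
    rw [Y_def, norm_mul, Complex.norm_real, Real.norm_of_nonneg (Real.exp_pos _).le,
      norm_compensatedExp_mul_exp]
    gcongr
    exact hc ω
  have integrable_succ := h.integrable_compensatedExp hc
  have integrable_self := h.integrable_compensatedExp (n := k) fun ω =>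
    (h.sum_condVar_le_of_le k.le_succ ω).trans (hc ω)
  have integrable_cube : Integrable (fun ω => |X k ω| ^ 3) μ :=
    ((h.memLp_four k).mono_exponent (by norm_num : (3 : ENNReal) ≤ 4)).integrable_norm_pow
      (p := 3) (by norm_num)
  calc _ = ‖∫ ω, (compensatedExp X q (k + 1) ω - compensatedExp X q k ω -
          Y ω * (X k ω * Complex.I + (q k ω - X k ω ^ 2) / 2)) ∂μ‖ := by
        rw [integral_sub (integrable_succ.sub' integrable_self) (h.integrable_mul k hY norm_Y),
          integral_sub integrable_succ integrable_self, h.integral_mul_eq_zero k hY norm_Y,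
          sub_zero]
    _ ≤ ∫ ω, Real.exp (c / 2) * (q k ω ^ 2 + 4 * |X k ω| ^ 3) ∂μ := by
        refine norm_integral_le_of_norm_le (((h.memLp_two_condVar k).integrable_sq.add
          (integrable_cube.const_mul 4)).const_mul _) (ae_of_all _ fun ω => ?_)
        refine (norm_compensatedExp_succ_sub_le X k (h.condVar_nonneg k ω)).trans ?_
        gcongr
        exact hc ω
    _ = _ := by
        rw [integral_const_mul, integral_add (h.memLp_two_condVar k).integrable_sq
          (integrable_cube.const_mul 4), integral_const_mul]

lemma sum_integral_abs_pow_three_le (h : IsMartingaleDifference μ F X q) {n : ℕ} {c : ℝ}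
    (hc : ∀ ω, ∑ k ∈ Finset.range n, q k ω ≤ c) :
    ∑ k ∈ Finset.range n, ∫ ω, |X k ω| ^ 3 ∂μ ≤
      √c * √(∑ k ∈ Finset.range n, ∫ ω, X k ω ^ 4 ∂μ) := by
  have sum_sq_le : ∑ k ∈ Finset.range n, ∫ ω, X k ω ^ 2 ∂μ ≤ c := by
    simp only [h.integral_sq]
    rw [← integral_finsetSum _ fun k _ => h.integrable_condVar k]
    simpa using integral_mono (integrable_finsetSum _ fun k _ => h.integrable_condVar k)
      (integrable_const c) hc
  calc _ ≤ ∑ k ∈ Finset.range n, √(∫ ω, X k ω ^ 2 ∂μ) * √(∫ ω, X k ω ^ 4 ∂μ) :=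
        Finset.sum_le_sum fun k _ => integral_abs_pow_three_le_sqrt (h.memLp_four k)
    _ ≤ √(∑ k ∈ Finset.range n, ∫ ω, X k ω ^ 2 ∂μ) *
          √(∑ k ∈ Finset.range n, ∫ ω, X k ω ^ 4 ∂μ) :=
        Real.sum_sqrt_mul_sqrt_le _ (fun k => integral_nonneg fun ω => by positivity)
          fun k => integral_nonneg fun ω => by positivity
    _ ≤ _ := by gcongr

lemma norm_integral_compensatedExp_sub_one_le (h : IsMartingaleDifference μ F X q) {n : ℕ}
    {c : ℝ} (hc : ∀ ω, ∑ k ∈ Finset.range n, q k ω ≤ c) :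
    ‖∫ ω, compensatedExp X q n ω ∂μ - 1‖ ≤
      Real.exp (c / 2) * (∑ k ∈ Finset.range n, ∫ ω, X k ω ^ 4 ∂μ +
        4 * (√c * √(∑ k ∈ Finset.range n, ∫ ω, X k ω ^ 4 ∂μ))) := by
  have telescope : ∫ ω, compensatedExp X q n ω ∂μ - 1 = ∑ k ∈ Finset.range n,
      (∫ ω, compensatedExp X q (k + 1) ω ∂μ - ∫ ω, compensatedExp X q k ω ∂μ) := by
    rw [Finset.sum_range_sub (fun k => ∫ ω, compensatedExp X q k ω ∂μ)]
    simp [compensatedExp]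
  calc _ ≤ ∑ k ∈ Finset.range n,
          Real.exp (c / 2) * (∫ ω, q k ω ^ 2 ∂μ + 4 * ∫ ω, |X k ω| ^ 3 ∂μ) := by
        rw [telescope]
        exact norm_sum_le_of_le _ fun k hk => h.norm_integral_compensatedExp_succ_sub_le fun ω =>
          (h.sum_condVar_le_of_le (Finset.mem_range.1 hk) ω).trans (hc ω)
    _ = Real.exp (c / 2) * (∑ k ∈ Finset.range n, ∫ ω, q k ω ^ 2 ∂μ +
          4 * ∑ k ∈ Finset.range n, ∫ ω, |X k ω| ^ 3 ∂μ) := by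
        rw [← Finset.mul_sum, Finset.sum_add_distrib, ← Finset.mul_sum]
    _ ≤ _ := by
        have quadratic := Finset.sum_le_sum fun k (_ : k ∈ Finset.range n) =>
          h.integral_condVar_sq_le k
        have cubic := h.sum_integral_abs_pow_three_le hc
        gcongr

lemma norm_charFn_sub_exp_le (h : IsMartingaleDifference μ F X q) {v : ℝ} (hv : 0 ≤ v) (n : ℕ) :
    ‖∫ ω, Complex.exp ((∑ k ∈ Finset.range n, X k ω : ℝ) * Complex.I) ∂μ - Real.exp (-v / 2)‖ ≤
      3 * ∫ ω, |∑ k ∈ Finset.range n, q k ω - v| ∂μ +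
        2 * (∑ k ∈ Finset.range n, ∫ ω, X k ω ^ 4 ∂μ +
          4 * (√(v + 1) * √(∑ k ∈ Finset.range n, ∫ ω, X k ω ^ 4 ∂μ))) := by
  set X' : ℕ → Ω → ℝ := fun k => (condVarSumLE q (v + 1) k).indicator (X k)
  set q' : ℕ → Ω → ℝ := fun k => (condVarSumLE q (v + 1) k).indicator (q k)
  set S : Ω → ℝ := fun ω => ∑ k ∈ Finset.range n, X k ω
  have stopped_le := h.sum_stopped_condVar_le (by positivity : 0 ≤ v + 1) n
  have integrable_Z : Integrable (compensatedExp X' q' n) μ :=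
    (h.stopped (v + 1)).integrable_compensatedExp stopped_le
  have integrable_exp : Integrable (fun ω => Complex.exp (S ω * Complex.I)) μ :=
    integrable_exp_mul_I (h.memLp_two_sum n).1
  have integrable_V : Integrable (fun ω => |∑ k ∈ Finset.range n, q k ω - v|) μ :=
    ((integrable_finsetSum _ fun k _ => h.integrable_condVar k).sub' (integrable_const v)).abs
  have fourth_le : ∑ k ∈ Finset.range n, ∫ ω, X' k ω ^ 4 ∂μ ≤
      ∑ k ∈ Finset.range n, ∫ ω, X k ω ^ 4 ∂μ :=
    Finset.sum_le_sum fun k _ => h.integral_stopped_pow_four_le (v + 1) k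
  calc _ = ‖∫ ω, (Complex.exp (S ω * Complex.I) - Real.exp (-v / 2) * compensatedExp X' q' n ω) ∂μ +
          Real.exp (-v / 2) * (∫ ω, compensatedExp X' q' n ω ∂μ - 1)‖ := by
        rw [integral_sub integrable_exp (integrable_Z.const_mul _), integral_const_mul,
          mul_sub_one, sub_add_sub_cancel]
    _ ≤ ∫ ω, 3 * |∑ k ∈ Finset.range n, q k ω - v| ∂μ +
          Real.exp (-v / 2) * (Real.exp ((v + 1) / 2) *
            (∑ k ∈ Finset.range n, ∫ ω, X' k ω ^ 4 ∂μ +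
              4 * (√(v + 1) * √(∑ k ∈ Finset.range n, ∫ ω, X' k ω ^ 4 ∂μ)))) := by
        refine (norm_add_le _ _).trans (add_le_add (norm_integral_le_of_norm_le
          (integrable_V.const_mul 3)
          (ae_of_all _ (h.norm_charFn_sub_compensatedExp_stopped_le hv n))) ?_)
        rw [norm_mul, Complex.norm_real, Real.norm_of_nonneg (Real.exp_pos _).le]
        gcongr
        exact (h.stopped (v + 1)).norm_integral_compensatedExp_sub_one_le stopped_le
    _ ≤ _ := by
        rw [integral_const_mul, ← mul_assoc (Real.exp _), ← Real.exp_add,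
          show -v / 2 + (v + 1) / 2 = 1 / 2 by ring]
        gcongr
        exact exp_half_le_two

end IsMartingaleDifference

theorem tendstoInDistribution_sum_gaussianReal_of_tendsto_condVar {Ω : ℕ → Type*}
    {m : ∀ n, MeasurableSpace (Ω n)} {μ : ∀ n, Measure (Ω n)} [∀ n, IsProbabilityMeasure (μ n)]
    {F : ∀ n, Filtration ℕ (m n)} {X q : ∀ n, ℕ → Ω n → ℝ}
    (h : ∀ n, IsMartingaleDifference (μ n) (F n) (X n) (q n)) (N : ℕ → ℕ) (v : NNReal)
    (hq : Tendsto (fun n => ∫ ω, |∑ k ∈ Finset.range (N n), q n k ω - v| ∂(μ n)) atTop (𝓝 0))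
    (hX : Tendsto (fun n => ∑ k ∈ Finset.range (N n), ∫ ω, X n k ω ^ 4 ∂(μ n)) atTop (𝓝 0)) :
    TendstoInDistribution (fun n ω => ∑ k ∈ Finset.range (N n), X n k ω) atTop (id : ℝ → ℝ) μ
      (gaussianReal 0 v) := by
  have hm (n : ℕ) : AEMeasurable (fun ω => ∑ k ∈ Finset.range (N n), X n k ω) (μ n) :=
    Finset.aemeasurable_fun_sum _ fun k _ => ((h n).integrable_diff k).aemeasurable
  refine ⟨hm, aemeasurable_id, ProbabilityMeasure.tendsto_iff_tendsto_charFun.2 fun t => ?_⟩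
  simp only [ProbabilityMeasure.coe_mk, Measure.map_id, charFun_gaussianReal]
  refine tendsto_iff_norm_sub_tendsto_zero.2 (squeeze_zero (fun n => norm_nonneg _) (fun n => ?_)
    (?_ : Tendsto (fun n => 3 * (t ^ 2 * ∫ ω, |∑ k ∈ Finset.range (N n), q n k ω - v| ∂(μ n)) +
        2 * (t ^ 4 * ∑ k ∈ Finset.range (N n), ∫ ω, X n k ω ^ 4 ∂(μ n) +
          4 * (√(t ^ 2 * v + 1) *
            √(t ^ 4 * ∑ k ∈ Finset.range (N n), ∫ ω, X n k ω ^ 4 ∂(μ n))))) atTop (𝓝 0)))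
  · have bound := ((h n).const_mul t).norm_charFn_sub_exp_le (v := t ^ 2 * v) (by positivity) (N n)
    simp only [← Finset.mul_sum, mul_pow, ← mul_sub, abs_mul, abs_sq, integral_const_mul] at bound
    rw [charFun_apply_real, integral_map (hm n) (by fun_prop)]
    convert! bound using 3
    · simp only [Complex.ofReal_mul]
    · push_cast
      congr 1
      ring
  · have fourth := hX.const_mul (t ^ 4)
    simpa using ((hq.const_mul (t ^ 2)).const_mul 3).add
      ((fourth.add ((fourth.sqrt.const_mul √(t ^ 2 * v + 1)).const_mul 4)).const_mul 2)

end MartingaleDifferences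

section FrobeniusNorm

variable {m n k : Type*} [Fintype m] [Fintype n] [Fintype k]

lemma frobenius_norm_sq (H : Matrix m n ℝ) : ‖H‖ ^ 2 = ∑ i, ∑ j, H i j ^ 2 := by
  rw [Matrix.frobenius_norm_def, ← Real.sqrt_eq_rpow, Real.sq_sqrt (by positivity)]
  simp only [Real.rpow_two, Real.norm_eq_abs, sq_abs]

lemma frobenius_norm_sq_eq_trace (H : Matrix m n ℝ) : ‖H‖ ^ 2 = (H * Hᵀ).trace := by
  rw [frobenius_norm_sq]
  simp only [Matrix.trace, Matrix.diag_apply, Matrix.mul_apply, Matrix.transpose_apply, sq]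

lemma trace_mul_le_frobenius_norm_mul (H : Matrix m n ℝ) (K : Matrix n m ℝ) :
    (H * K).trace ≤ ‖H‖ * ‖K‖ := by
  have cauchy_schwarz := Real.sum_mul_le_sqrt_mul_sqrt Finset.univ
    (fun p : m × n => H p.1 p.2) fun p => Kᵀ p.1 p.2
  simp only [Fintype.sum_prod_type, ← frobenius_norm_sq] at cauchy_schwarz
  rwa [Real.sqrt_sq (norm_nonneg _), Real.sqrt_sq (norm_nonneg _),
    Matrix.frobenius_norm_transpose] at cauchy_schwarz

lemma frobenius_norm_transpose_mul_sq (H : Matrix m n ℝ) (K : Matrix m k ℝ) :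
    ‖Hᵀ * K‖ ^ 2 = (H * Hᵀ * (K * Kᵀ)).trace := by
  rw [frobenius_norm_sq_eq_trace, Matrix.transpose_mul, Matrix.transpose_transpose,
    Matrix.mul_assoc, ← Matrix.mul_assoc K, ← Matrix.mul_assoc, Matrix.trace_mul_comm,
    ← Matrix.mul_assoc]

lemma frobenius_norm_transpose_mul_sq_le (H : Matrix m n ℝ) (K : Matrix m k ℝ) :
    ‖Hᵀ * K‖ ^ 2 ≤ ‖H * Hᵀ‖ * ‖K * Kᵀ‖ :=
  (frobenius_norm_transpose_mul_sq H K).trans_le (trace_mul_le_frobenius_norm_mul _ _)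

lemma frobenius_norm_gram_transpose (H : Matrix m n ℝ) : ‖Hᵀ * H‖ = ‖H * Hᵀ‖ := by
  rw [← sq_eq_sq₀ (norm_nonneg _) (norm_nonneg _), frobenius_norm_transpose_mul_sq,
    frobenius_norm_sq_eq_trace, Matrix.transpose_mul, Matrix.transpose_transpose]

lemma frobenius_norm_diagonal_mul_gram_le [DecidableEq m] {D : m → ℝ} {c : ℝ}
    (hD : ∀ i, |D i| ≤ c) (H : Matrix m n ℝ) :
    ‖(Matrix.diagonal D * H) * (Matrix.diagonal D * H)ᵀ‖ ≤ c ^ 2 * ‖H * Hᵀ‖ := by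
  rw [← pow_le_pow_iff_left₀ (norm_nonneg _) (by positivity) two_ne_zero, mul_pow,
    frobenius_norm_sq, frobenius_norm_sq]
  simp only [Finset.mul_sum]
  gcongr with i _ j _
  have entry : (Matrix.diagonal D * H * (Matrix.diagonal D * H)ᵀ) i j =
      D i * D j * (H * Hᵀ) i j := by
    rw [Matrix.transpose_mul, Matrix.diagonal_transpose, ← Matrix.mul_assoc, Matrix.mul_diagonal,
      Matrix.mul_assoc, Matrix.diagonal_mul]
    ring
  rw [entry, mul_pow]
  refine mul_le_mul_of_nonneg_right ?_ (sq_nonneg _)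
  rw [sq_le_sq, abs_mul, abs_of_nonneg (sq_nonneg c), sq]
  have hc : 0 ≤ c := (abs_nonneg _).trans (hD i)
  exact mul_le_mul (hD i) (hD j) (abs_nonneg _) hc

lemma sum_vecMul_sq_le (r : m → ℝ) (H : Matrix m n ℝ) :
    ∑ j, (r ᵥ* H) j ^ 2 ≤ ‖H * Hᵀ‖ * ∑ i, r i ^ 2 := by
  set R : Matrix m Unit ℝ := Matrix.replicateCol Unit r
  calc ∑ j, (r ᵥ* H) j ^ 2 = ‖Hᵀ * R‖ ^ 2 := by
        rw [frobenius_norm_sq]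
        simp [R, Matrix.mul_apply, Matrix.vecMul, dotProduct, mul_comm]
    _ ≤ ‖H * Hᵀ‖ * ‖R * Rᵀ‖ := frobenius_norm_transpose_mul_sq_le H R
    _ ≤ ‖H * Hᵀ‖ * (‖R‖ * ‖Rᵀ‖) := by
        gcongr
        exact Matrix.frobenius_norm_mul R Rᵀ
    _ = ‖H * Hᵀ‖ * ∑ i, r i ^ 2 := by
        rw [Matrix.frobenius_norm_transpose, ← sq, frobenius_norm_sq]
        simp [R]

lemma sum_sq_sum_row_sq_le (H : Matrix m n ℝ) :
    ∑ i, (∑ j, H i j ^ 2) ^ 2 ≤ ‖H * Hᵀ‖ ^ 2 := by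
  rw [frobenius_norm_sq]
  refine Finset.sum_le_sum fun i _ => ?_
  have diag : ∑ j, H i j ^ 2 = (H * Hᵀ) i i := by
    simp only [Matrix.mul_apply, Matrix.transpose_apply, sq]
  rw [diag]
  exact Finset.single_le_sum (f := fun j => (H * Hᵀ) i j ^ 2) (fun j _ => sq_nonneg _)
    (Finset.mem_univ i)

lemma frobenius_norm_gram_le_norm_add (H : Matrix m n ℝ) (K : Matrix m k ℝ) :
    ‖H * Hᵀ‖ ≤ ‖H * Hᵀ + K * Kᵀ‖ := by
  have sq_le : ‖H * Hᵀ‖ * ‖H * Hᵀ‖ ≤ ‖H * Hᵀ‖ * ‖H * Hᵀ + K * Kᵀ‖ := by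
    calc ‖H * Hᵀ‖ * ‖H * Hᵀ‖ ≤ ‖H * Hᵀ‖ ^ 2 + ‖Hᵀ * K‖ ^ 2 := by
          rw [← sq]
          exact le_add_of_nonneg_right (sq_nonneg _)
      _ = (H * Hᵀ * (H * Hᵀ + K * Kᵀ)).trace := by
          rw [← frobenius_norm_gram_transpose, frobenius_norm_transpose_mul_sq,
            frobenius_norm_transpose_mul_sq, Matrix.mul_add, Matrix.trace_add]
      _ ≤ ‖H * Hᵀ‖ * ‖H * Hᵀ + K * Kᵀ‖ := trace_mul_le_frobenius_norm_mul _ _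
  rcases (norm_nonneg (H * Hᵀ)).eq_or_lt with h0 | h0
  · exact h0.symm.trans_le (norm_nonneg _)
  · exact le_of_mul_le_mul_left sq_le h0

lemma frobenius_norm_gram_add_le (H K : Matrix m n ℝ) :
    ‖(H + K) * (H + K)ᵀ‖ ≤ 2 * (‖H * Hᵀ‖ + ‖K * Kᵀ‖) := by
  have parallelogram : (H + K) * (H + K)ᵀ + (H - K) * (H - K)ᵀ =
      (H * Hᵀ + K * Kᵀ) + (H * Hᵀ + K * Kᵀ) := by
    simp only [Matrix.transpose_add, Matrix.transpose_sub, Matrix.add_mul, Matrix.mul_add,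
      Matrix.sub_mul, Matrix.mul_sub]
    abel
  calc _ ≤ ‖(H * Hᵀ + K * Kᵀ) + (H * Hᵀ + K * Kᵀ)‖ :=
        parallelogram ▸ frobenius_norm_gram_le_norm_add _ _
    _ ≤ (‖H * Hᵀ‖ + ‖K * Kᵀ‖) + (‖H * Hᵀ‖ + ‖K * Kᵀ‖) :=
        norm_add_le_of_le (norm_add_le _ _) (norm_add_le _ _)
    _ = _ := (two_mul _).symm

lemma frobenius_norm_gram_smul (c : ℝ) (H : Matrix m n ℝ) :
    ‖(c • H) * (c • H)ᵀ‖ = c ^ 2 * ‖H * Hᵀ‖ := by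
  let := Matrix.frobeniusNormedSpace (m := m) (n := m) (R := ℝ) (α := ℝ)
  rw [Matrix.transpose_smul, Matrix.smul_mul, Matrix.mul_smul, smul_smul, norm_smul, ← sq,
    Real.norm_of_nonneg (sq_nonneg c)]

end FrobeniusNorm

section Independence

variable {Ω ι E : Type*} {m : MeasurableSpace Ω} [mE : MeasurableSpace E] {μ : Measure Ω}

/-- The σ-algebra generated by the random variables `v j` with `j ∈ S`, as a supremum so that it
applies to index sets that are neither ordered nor finite. -/
@[reducible] def generatedBy (v : ι → Ω → E) (S : Set ι) : MeasurableSpace Ω :=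
  ⨆ j ∈ S, mE.comap (v j)

lemma generatedBy_le {v : ι → Ω → E} (hv : ∀ j, Measurable (v j)) (S : Set ι) :
    generatedBy v S ≤ m :=
  iSup₂_le fun j _ => (hv j).comap_le

lemma generatedBy_mono (v : ι → Ω → E) {S T : Set ι} (h : S ⊆ T) :
    generatedBy v S ≤ generatedBy v T :=
  biSup_mono fun _ hj => h hj

lemma measurable_generatedBy (v : ι → Ω → E) {S : Set ι} {j : ι} (hj : j ∈ S) :
    Measurable[generatedBy v S] (v j) :=
  Measurable.of_comap_le (le_biSup (fun j => mE.comap (v j)) hj)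

lemma indep_generatedBy_comap {v : ι → Ω → E} (hv : ∀ j, Measurable (v j)) (hind : iIndepFun v μ)
    {S : Set ι} {a : ι} (ha : a ∉ S) : Indep (generatedBy v S) (mE.comap (v a)) μ := by
  simpa [generatedBy] using indep_iSup_of_disjoint (fun j => (hv j).comap_le) hind
    (Set.disjoint_singleton_right.2 ha)

lemma indepFun_of_measurable_generatedBy {α : Type*} [MeasurableSpace α] {v : ι → Ω → E}
    (hv : ∀ j, Measurable (v j)) (hind : iIndepFun v μ) {S : Set ι} {a : ι} (ha : a ∉ S)
    {f : Ω → α} (hf : Measurable[generatedBy v S] f) : IndepFun f (v a) μ := by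
  rw [IndepFun_iff_Indep]
  exact indep_of_indep_of_le_left (indep_generatedBy_comap hv hind ha) hf.comap_le

end Independence

section Moments

variable {Ω ι : Type*} {m : MeasurableSpace Ω} {μ : Measure Ω}

lemma pow_four_sum_le (S : Finset ι) (f : ι → ℝ) :
    (∑ i ∈ S, f i) ^ 4 ≤ (S.card : ℝ) ^ 3 * ∑ i ∈ S, f i ^ 4 := by
  calc (∑ i ∈ S, f i) ^ 4 = ((∑ i ∈ S, f i) ^ 2) ^ 2 := by ring
    _ ≤ (S.card * ∑ i ∈ S, f i ^ 2) ^ 2 := by gcongr; exact sq_sum_le_card_mul_sum_sq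
    _ = (S.card : ℝ) ^ 2 * (∑ i ∈ S, f i ^ 2) ^ 2 := by ring
    _ ≤ (S.card : ℝ) ^ 2 * (S.card * ∑ i ∈ S, (f i ^ 2) ^ 2) := by
        gcongr; exact sq_sum_le_card_mul_sum_sq
    _ = (S.card : ℝ) ^ 3 * ∑ i ∈ S, f i ^ 4 := by simp_rw [← pow_mul]; ring

lemma variance_sum_le [IsFiniteMeasure μ] {f : ι → Ω → ℝ} (S : Finset ι)
    (hf : ∀ i ∈ S, MemLp (f i) 2 μ) :
    Var[fun ω => ∑ i ∈ S, f i ω; μ] ≤ S.card * ∑ i ∈ S, Var[f i; μ] := by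
  have integrable_sq : ∀ i ∈ S, Integrable (fun ω => (f i ω - μ[f i]) ^ 2) μ := fun i hi =>
    ((hf i hi).sub (memLp_const _)).integrable_sq
  calc Var[fun ω => ∑ i ∈ S, f i ω; μ] = ∫ ω, (∑ i ∈ S, (f i ω - μ[f i])) ^ 2 ∂μ := by
        rw [variance_eq_integral (Finset.aemeasurable_fun_sum _ fun i hi => (hf i hi).aemeasurable),
          integral_finsetSum _ fun i hi => (hf i hi).integrable (by norm_num)]
        simp only [Finset.sum_sub_distrib]
    _ ≤ ∫ ω, (S.card : ℝ) * ∑ i ∈ S, (f i ω - μ[f i]) ^ 2 ∂μ :=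
        integral_mono_of_nonneg (ae_of_all _ fun ω => sq_nonneg _)
          ((integrable_finsetSum _ integrable_sq).const_mul _)
          (ae_of_all _ fun ω => sq_sum_le_card_mul_sum_sq)
    _ = S.card * ∑ i ∈ S, Var[f i; μ] := by
        rw [integral_const_mul, integral_finsetSum _ integrable_sq]
        congr 1
        exact Finset.sum_congr rfl fun i hi => (variance_eq_integral (hf i hi).aemeasurable).symm

lemma variance_add_le [IsFiniteMeasure μ] {f g : Ω → ℝ} (hf : MemLp f 2 μ) (hg : MemLp g 2 μ) :
    Var[fun ω => f ω + g ω; μ] ≤ 2 * (Var[f; μ] + Var[g; μ]) := by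
  simpa [Fin.sum_univ_two] using variance_sum_le (f := ![f, g]) Finset.univ
    (by simp [Fin.forall_fin_two, hf, hg])

section LinearForm

lemma integral_add_pow_four_of_indepFun {f g : Ω → ℝ} (h : IndepFun f g μ) (hf : MemLp f 4 μ)
    (hg : MemLp g 4 μ) (hf0 : ∫ ω, f ω ∂μ = 0) (hg0 : ∫ ω, g ω ∂μ = 0) :
    ∫ ω, (f ω + g ω) ^ 4 ∂μ =
      ∫ ω, f ω ^ 4 ∂μ + 6 * ((∫ ω, f ω ^ 2 ∂μ) * ∫ ω, g ω ^ 2 ∂μ) + ∫ ω, g ω ^ 4 ∂μ := by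
  have integral_mul_pow (p r : ℕ) :
      ∫ ω, f ω ^ p * g ω ^ r ∂μ = (∫ ω, f ω ^ p ∂μ) * ∫ ω, g ω ^ r ∂μ :=
    IndepFun.integral_fun_mul_eq_mul_integral
      (h.comp (measurable_id.pow_const p) (measurable_id.pow_const r)) (hf.1.pow p) (hg.1.pow r)
  have hf4 := (memLp_four_iff_integrable_pow hf.1).1 hf
  have hg4 := (memLp_four_iff_integrable_pow hg.1).1 hg
  have h22 : Integrable (fun ω => 6 * (f ω ^ 2 * g ω ^ 2)) μ :=
    ((memLp_two_sq_of_memLp_four hf).integrable_mul (memLp_two_sq_of_memLp_four hg)).const_mul 6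
  have h31 : Integrable (fun ω => 4 * (f ω ^ 3 * g ω ^ 1)) μ := by
    convert! ((memLp_two_sq_of_memLp_four hf).integrable_mul
      (memLp_two_mul_of_memLp_four hf hg)).const_mul 4 using 2 with ω
    simp only [Pi.mul_apply]
    ring
  have h13 : Integrable (fun ω => 4 * (f ω ^ 1 * g ω ^ 3)) μ := by
    convert! ((memLp_two_sq_of_memLp_four hg).integrable_mul
      (memLp_two_mul_of_memLp_four hf hg)).const_mul 4 using 2 with ω
    simp only [Pi.mul_apply]
    ring
  have binomial : ∀ ω, (f ω + g ω) ^ 4 = f ω ^ 4 + 6 * (f ω ^ 2 * g ω ^ 2) + g ω ^ 4 +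
      4 * (f ω ^ 3 * g ω ^ 1) + 4 * (f ω ^ 1 * g ω ^ 3) := fun ω => by ring
  simp_rw [binomial]
  rw [integral_add ((((hf4.fun_add h22).fun_add hg4).fun_add h31)) h13,
    integral_add ((hf4.fun_add h22).fun_add hg4) h31, integral_add (hf4.fun_add h22) hg4,
    integral_add hf4 h22, integral_const_mul, integral_const_mul, integral_const_mul,
    integral_mul_pow, integral_mul_pow, integral_mul_pow]
  simp [hf0, hg0]

variable {x : ι → Ω → ℝ}

lemma integral_sum_eq_zero (hx : ∀ j, Integrable (x j) μ) (h0 : ∀ j, ∫ ω, x j ω ∂μ = 0)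
    (S : Finset ι) : ∫ ω, ∑ j ∈ S, x j ω ∂μ = 0 := by
  rw [integral_finsetSum _ fun j _ => hx j]
  exact Finset.sum_eq_zero fun j _ => h0 j

variable [IsProbabilityMeasure μ]

lemma integral_sum_sq_of_iIndepFun (hind : iIndepFun x μ) (hx : ∀ j, MemLp (x j) 2 μ)
    (h0 : ∀ j, ∫ ω, x j ω ∂μ = 0) (S : Finset ι) :
    ∫ ω, (∑ j ∈ S, x j ω) ^ 2 ∂μ = ∑ j ∈ S, ∫ ω, x j ω ^ 2 ∂μ := by
  have variance_sum := IndepFun.variance_sum (s := S) (fun j _ => hx j)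
    fun j _ k _ hjk => hind.indepFun hjk
  have sum_eq : (∑ j ∈ S, x j) = fun ω => ∑ j ∈ S, x j ω := by ext ω; simp
  rw [sum_eq, variance_of_integral_eq_zero
    (Finset.aemeasurable_fun_sum _ fun j _ => (hx j).aemeasurable)
    (integral_sum_eq_zero (fun j => (hx j).integrable (by norm_num)) h0 S)] at variance_sum
  simpa only [variance_of_integral_eq_zero (hx _).aemeasurable (h0 _)] using variance_sum

lemma integral_sum_pow_four_le (hind : iIndepFun x μ) (hx : ∀ j, MemLp (x j) 4 μ)
    (h0 : ∀ j, ∫ ω, x j ω ∂μ = 0) {τ : ι → ℝ} (hτ : ∀ j, 0 ≤ τ j)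
    (h4 : ∀ j, ∫ ω, x j ω ^ 4 ∂μ ≤ τ j ^ 2) (S : Finset ι) :
    ∫ ω, (∑ j ∈ S, x j ω) ^ 4 ∂μ ≤ 3 * (∑ j ∈ S, τ j) ^ 2 := by
  classical
  have integral_sq_le : ∀ j, ∫ ω, x j ω ^ 2 ∂μ ≤ τ j := fun j =>
    integral_sq_le_of_integral_pow_four_le (hx j) (hτ j) (h4 j)
  induction S using Finset.induction_on with
  | empty => simp
  | insert a S ha ih =>
    have integral_sum_sq_le : ∫ ω, (∑ j ∈ S, x j ω) ^ 2 ∂μ ≤ ∑ j ∈ S, τ j := by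
      rw [integral_sum_sq_of_iIndepFun hind (fun j => (hx j).mono_exponent (by norm_num)) h0]
      exact Finset.sum_le_sum fun j _ => integral_sq_le j
    have indep_sum : IndepFun (x a) (fun ω => ∑ j ∈ S, x j ω) μ := by
      simpa only [Finset.sum_fn] using
        (hind.indepFun_finsetSum_of_notMem₀ (fun j => (hx j).aemeasurable) ha).symm
    simp only [Finset.sum_insert ha]
    rw [integral_add_pow_four_of_indepFun indep_sum (hx a) (memLp_finsetSum _ fun j _ => hx j)
      (h0 a) (integral_sum_eq_zero (fun j => (hx j).integrable (by norm_num)) h0 S)]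
    have mul_le := mul_le_mul (integral_sq_le a) integral_sum_sq_le (by positivity) (hτ a)
    linarith [h4 a, sq_nonneg (τ a)]

lemma integral_sum_const_mul_sq_le (hind : iIndepFun x μ) (hx : ∀ j, MemLp (x j) 2 μ)
    (h0 : ∀ j, ∫ ω, x j ω ∂μ = 0) {κ : ℝ} (h2 : ∀ j, ∫ ω, x j ω ^ 2 ∂μ ≤ κ) (c : ι → ℝ)
    (S : Finset ι) : ∫ ω, (∑ j ∈ S, c j * x j ω) ^ 2 ∂μ ≤ κ * ∑ j ∈ S, c j ^ 2 := by
  refine (integral_sum_sq_of_iIndepFun (hind.comp _ fun j => measurable_const_mul (c j))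
    (fun j => (hx j).const_mul (c j)) (fun j => by simp [integral_const_mul, h0]) S).trans_le ?_
  rw [Finset.mul_sum]
  refine Finset.sum_le_sum fun j _ => ?_
  simp only [Function.comp_apply, mul_pow, integral_const_mul, mul_comm κ]
  gcongr
  exact h2 j

lemma integral_sum_const_mul_pow_four_le (hind : iIndepFun x μ) (hx : ∀ j, MemLp (x j) 4 μ)
    (h0 : ∀ j, ∫ ω, x j ω ∂μ = 0) {κ : ℝ} (hκ : 0 ≤ κ) (h4 : ∀ j, ∫ ω, x j ω ^ 4 ∂μ ≤ κ ^ 2)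
    (c : ι → ℝ) (S : Finset ι) :
    ∫ ω, (∑ j ∈ S, c j * x j ω) ^ 4 ∂μ ≤ 3 * (κ * ∑ j ∈ S, c j ^ 2) ^ 2 := by
  rw [Finset.mul_sum]
  refine integral_sum_pow_four_le (hind.comp _ fun j => measurable_const_mul (c j))
    (fun j => (hx j).const_mul (c j)) (fun j => by simp [integral_const_mul, h0])
    (fun j => by positivity) (fun j => ?_) S
  calc ∫ ω, (c j * x j ω) ^ 4 ∂μ = c j ^ 4 * ∫ ω, x j ω ^ 4 ∂μ := by
        simp only [mul_pow, integral_const_mul]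
    _ ≤ c j ^ 4 * κ ^ 2 := by gcongr; exact h4 j
    _ = (κ * c j ^ 2) ^ 2 := by ring

end LinearForm

section QuadraticForm

lemma sum_sum_insert {R : Type*} [AddCommMonoid R] [DecidableEq ι] {S : Finset ι} {a : ι}
    (ha : a ∉ S) (f : ι → ι → R) : ∑ j ∈ insert a S, ∑ k ∈ insert a S, f j k =
      ∑ j ∈ S, ∑ k ∈ S, f j k + (f a a + (∑ k ∈ S, f a k + ∑ k ∈ S, f k a)) := by
  simp only [Finset.sum_insert ha, Finset.sum_add_distrib]
  abel

lemma memLp_two_mul_of_indepFun {f g : Ω → ℝ} (h : IndepFun f g μ) (hf : MemLp f 2 μ)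
    (hg : MemLp g 2 μ) : MemLp (fun ω => f ω * g ω) 2 μ := by
  refine (memLp_two_iff_integrable_sq (hf.1.mul hg.1)).2 ?_
  convert! (h.comp (measurable_id.pow_const 2) (measurable_id.pow_const 2)).integrable_mul
    hf.integrable_sq hg.integrable_sq using 2 with ω
  simp [mul_pow]

lemma indepFun_sum_sum_mul_prodMk {x y : ι → Ω → ℝ} (hxm : ∀ j, Measurable (x j))
    (hym : ∀ j, Measurable (y j)) (hind : iIndepFun (fun j ω => (x j ω, y j ω)) μ)
    (M : Matrix ι ι ℝ) {S : Finset ι} {a : ι} (ha : a ∉ S) :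
    IndepFun (fun ω => (∑ j ∈ S, ∑ k ∈ S, M j k * (x j ω * y k ω), ∑ k ∈ S, M a k * y k ω,
      ∑ k ∈ S, M k a * x k ω)) (fun ω => (x a ω, y a ω)) μ := by
  have measurable_x : ∀ j ∈ S, Measurable[generatedBy (fun j ω => (x j ω, y j ω)) S] (x j) :=
    fun j hj => measurable_fst.comp (measurable_generatedBy (S := (S : Set ι)) _ hj)
  have measurable_y : ∀ j ∈ S, Measurable[generatedBy (fun j ω => (x j ω, y j ω)) S] (y j) :=
    fun j hj => measurable_snd.comp (measurable_generatedBy (S := (S : Set ι)) _ hj)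
  exact indepFun_of_measurable_generatedBy (fun j => (hxm j).prodMk (hym j)) hind
    (S := (S : Set ι)) (by simpa using ha)
    ((Finset.measurable_fun_sum S fun j hj => Finset.measurable_fun_sum S fun k hk =>
      ((measurable_x j hj).mul (measurable_y k hk)).const_mul (M j k)).prodMk
    ((Finset.measurable_fun_sum S fun k hk => (measurable_y k hk).const_mul (M a k)).prodMk
      (Finset.measurable_fun_sum S fun k hk => (measurable_x k hk).const_mul (M k a))))

variable [IsProbabilityMeasure μ]

lemma variance_mul_le_of_indepFun {f g : Ω → ℝ} (h : IndepFun f g μ) (hf : MemLp f 2 μ)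
    (hg : MemLp g 2 μ) {κ : ℝ} (hgκ : ∫ ω, g ω ^ 2 ∂μ ≤ κ) :
    Var[fun ω => f ω * g ω; μ] ≤ κ * ∫ ω, f ω ^ 2 ∂μ := by
  have indep_sq : IndepFun (fun ω => f ω ^ 2) (fun ω => g ω ^ 2) μ :=
    h.comp (measurable_id.pow_const 2) (measurable_id.pow_const 2)
  calc Var[fun ω => f ω * g ω; μ] ≤ ∫ ω, f ω ^ 2 * g ω ^ 2 ∂μ := by
        simpa only [Pi.pow_apply, Pi.mul_apply, mul_pow] using!
          variance_le_expectation_sq (hf.1.mul hg.1)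
    _ = (∫ ω, g ω ^ 2 ∂μ) * ∫ ω, f ω ^ 2 ∂μ := by
        rw [indep_sq.integral_fun_mul_eq_mul_integral (hf.1.pow 2) (hg.1.pow 2), mul_comm]
    _ ≤ κ * ∫ ω, f ω ^ 2 ∂μ := by gcongr

lemma covariance_mul_eq_zero_of_indepFun {f g z : Ω → ℝ}
    (h : IndepFun (fun ω => (f ω, g ω)) z μ) (hf : MemLp f 2 μ) (hg : MemLp g 2 μ)
    (hz : MemLp z 2 μ) (hz0 : ∫ ω, z ω ∂μ = 0) : cov[f, fun ω => g ω * z ω; μ] = 0 := by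
  have hgz : IndepFun g z μ := h.comp measurable_snd measurable_id
  have hfgz : IndepFun (fun ω => f ω * g ω) z μ :=
    h.comp (measurable_fst.mul measurable_snd) measurable_id
  have integral_gz : ∫ ω, g ω * z ω ∂μ = 0 := by
    rw [hgz.integral_fun_mul_eq_mul_integral hg.1 hz.1, hz0, mul_zero]
  have integral_fgz : ∫ ω, f ω * (g ω * z ω) ∂μ = 0 := by
    simp only [← mul_assoc]
    rw [hfgz.integral_fun_mul_eq_mul_integral (hf.1.mul hg.1) hz.1, hz0, mul_zero]
  rw [covariance_eq_sub hf (memLp_two_mul_of_indepFun hgz hg hz), integral_gz, mul_zero, sub_zero]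
  exact integral_fgz

lemma variance_add_bilinear_le {U L₁ L₂ x y : Ω → ℝ}
    (h : IndepFun (fun ω => (U ω, L₁ ω, L₂ ω)) (fun ω => (x ω, y ω)) μ)
    (hU : MemLp U 2 μ) (hL₁ : MemLp L₁ 2 μ) (hL₂ : MemLp L₂ 2 μ)
    (hx : MemLp x 4 μ) (hy : MemLp y 4 μ) (hx0 : ∫ ω, x ω ∂μ = 0) (hy0 : ∫ ω, y ω ∂μ = 0) {κ : ℝ}
    (hxκ : ∫ ω, x ω ^ 2 ∂μ ≤ κ) (hyκ : ∫ ω, y ω ^ 2 ∂μ ≤ κ)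
    (hxyκ : ∫ ω, (x ω * y ω) ^ 2 ∂μ ≤ κ ^ 2) (c : ℝ) :
    Var[fun ω => U ω + (c * (x ω * y ω) + (L₁ ω * x ω + L₂ ω * y ω)); μ] ≤
      Var[U; μ] + 4 * (κ ^ 2 * c ^ 2 + κ * ∫ ω, L₁ ω ^ 2 ∂μ + κ * ∫ ω, L₂ ω ^ 2 ∂μ) := by
  have hx2 : MemLp x 2 μ := hx.mono_exponent (by norm_num)
  have hy2 : MemLp y 2 μ := hy.mono_exponent (by norm_num)
  have hxy : MemLp (fun ω => c * (x ω * y ω)) 2 μ := (memLp_two_mul_of_memLp_four hx hy).const_mul c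
  have indep_L₁ : IndepFun L₁ x μ := h.comp (measurable_fst.comp measurable_snd) measurable_fst
  have indep_L₂ : IndepFun L₂ y μ := h.comp (measurable_snd.comp measurable_snd) measurable_snd
  have hL₁x := memLp_two_mul_of_indepFun indep_L₁ hL₁ hx2
  have hL₂y := memLp_two_mul_of_indepFun indep_L₂ hL₂ hy2
  have hL : MemLp (fun ω => L₁ ω * x ω + L₂ ω * y ω) 2 μ := hL₁x.add hL₂y
  have cov_xy : cov[U, fun ω => c * (x ω * y ω); μ] = 0 :=
    (h.comp measurable_fst ((measurable_fst.mul measurable_snd).const_mul c)).covariance_eq_zero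
      hU hxy
  have cov_L₁ : cov[U, fun ω => L₁ ω * x ω; μ] = 0 := covariance_mul_eq_zero_of_indepFun
    (h.comp (measurable_fst.prodMk (measurable_fst.comp measurable_snd)) measurable_fst)
    hU hL₁ hx2 hx0
  have cov_L₂ : cov[U, fun ω => L₂ ω * y ω; μ] = 0 := covariance_mul_eq_zero_of_indepFun
    (h.comp (measurable_fst.prodMk (measurable_snd.comp measurable_snd)) measurable_snd)
    hU hL₂ hy2 hy0
  have cov_eq_zero : cov[U, fun ω => c * (x ω * y ω) + (L₁ ω * x ω + L₂ ω * y ω); μ] = 0 := by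
    refine (covariance_add_right hU hxy hL).trans ?_
    rw [cov_xy, zero_add]
    exact (covariance_add_right hU hL₁x hL₂y).trans (by rw [cov_L₁, cov_L₂, add_zero])
  have var_xy : Var[fun ω => c * (x ω * y ω); μ] ≤ κ ^ 2 * c ^ 2 := by
    rw [variance_const_mul, mul_comm]
    gcongr
    exact (variance_le_expectation_sq (hx.1.mul hy.1)).trans hxyκ
  have var_L₁ := variance_mul_le_of_indepFun indep_L₁ hL₁ hx2 hxκ
  have var_L₂ := variance_mul_le_of_indepFun indep_L₂ hL₂ hy2 hyκ
  have hD : MemLp (fun ω => c * (x ω * y ω) + (L₁ ω * x ω + L₂ ω * y ω)) 2 μ := hxy.add hL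
  rw [variance_fun_add hU hD, cov_eq_zero]
  linarith [variance_add_le hxy hL, variance_add_le hL₁x hL₂y, sq_nonneg (κ * c)]

/- Adding the index `a` to `S` changes the quadratic form by the terms of
`variance_add_bilinear_le`, with `L₁` and `L₂` linear in the variables indexed by `S`. -/
lemma variance_sum_sum_mul_le {x y : ι → Ω → ℝ} (hxm : ∀ j, Measurable (x j))
    (hym : ∀ j, Measurable (y j)) (hind : iIndepFun (fun j ω => (x j ω, y j ω)) μ)
    (hx : ∀ j, MemLp (x j) 4 μ) (hy : ∀ j, MemLp (y j) 4 μ)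
    (hx0 : ∀ j, ∫ ω, x j ω ∂μ = 0) (hy0 : ∀ j, ∫ ω, y j ω ∂μ = 0) {κ : ℝ} (hκ : 0 ≤ κ)
    (hx4 : ∀ j, ∫ ω, x j ω ^ 4 ∂μ ≤ κ ^ 2) (hy4 : ∀ j, ∫ ω, y j ω ^ 4 ∂μ ≤ κ ^ 2)
    (M : Matrix ι ι ℝ) (S : Finset ι) :
    Var[fun ω => ∑ j ∈ S, ∑ k ∈ S, M j k * (x j ω * y k ω); μ] ≤
      4 * κ ^ 2 * ∑ j ∈ S, ∑ k ∈ S, M j k ^ 2 := by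
  classical
  induction S using Finset.induction_on with
  | empty => simpa only [Finset.sum_empty, mul_zero] using! (variance_zero μ).le
  | insert a S ha ih =>
    have hx2 : ∀ j, ∫ ω, x j ω ^ 2 ∂μ ≤ κ := fun j =>
      integral_sq_le_of_integral_pow_four_le (hx j) hκ (hx4 j)
    have hy2 : ∀ j, ∫ ω, y j ω ^ 2 ∂μ ≤ κ := fun j =>
      integral_sq_le_of_integral_pow_four_le (hy j) hκ (hy4 j)
    have var_insert := variance_add_bilinear_le (indepFun_sum_sum_mul_prodMk hxm hym hind M ha)
      (memLp_finsetSum _ fun j _ => memLp_finsetSum _ fun k _ =>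
        (memLp_two_mul_of_memLp_four (hx j) (hy k)).const_mul _)
      (memLp_finsetSum _ fun k _ => ((hy k).mono_exponent (by norm_num)).const_mul _)
      (memLp_finsetSum _ fun k _ => ((hx k).mono_exponent (by norm_num)).const_mul _)
      (hx a) (hy a) (hx0 a) (hy0 a) (hx2 a) (hy2 a)
      (integral_mul_sq_le_of_integral_pow_four_le (hx a) (hy a) (hx4 a) (hy4 a)) (M a a)
    have sum_sq_y := mul_le_mul_of_nonneg_left (integral_sum_const_mul_sq_le (x := y)
      (hind.comp (fun _ => Prod.snd) fun _ => measurable_snd)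
      (fun j => (hy j).mono_exponent (by norm_num)) hy0 hy2 (fun k => M a k) S) hκ
    have sum_sq_x := mul_le_mul_of_nonneg_left (integral_sum_const_mul_sq_le (x := x)
      (hind.comp (fun _ => Prod.fst) fun _ => measurable_fst)
      (fun j => (hx j).mono_exponent (by norm_num)) hx0 hx2 (fun k => M k a) S) hκ
    have form_insert : ∀ ω, ∑ j ∈ insert a S, ∑ k ∈ insert a S, M j k * (x j ω * y k ω) =
        ∑ j ∈ S, ∑ k ∈ S, M j k * (x j ω * y k ω) + (M a a * (x a ω * y a ω) +
          ((∑ k ∈ S, M a k * y k ω) * x a ω + (∑ k ∈ S, M k a * x k ω) * y a ω)) := fun ω => by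
      rw [sum_sum_insert ha]
      simp only [Finset.sum_mul, mul_assoc, mul_comm (x a ω)]
    simp only [form_insert]
    rw [sum_sum_insert ha]
    linarith

end QuadraticForm

end Moments

section SecondMoment

variable {Ω δ : Type*} {m : MeasurableSpace Ω} {μ : Measure Ω}

/-- The matrix `E[u u']` of second moments of a random vector `u`, which is its covariance matrix
when `u` is centered. -/
noncomputable def secondMoment (μ : Measure Ω) (u : Ω → δ → ℝ) : Matrix δ δ ℝ :=
  Matrix.of fun l l' => ∫ ω, u ω l * u ω l' ∂μ

variable {u : Ω → δ → ℝ}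

lemma isSymm_secondMoment : (secondMoment μ u).IsSymm :=
  Matrix.IsSymm.ext fun l l' => by simp only [secondMoment, Matrix.of_apply, mul_comm]

lemma abs_secondMoment_le {κ : ℝ} (hκ : 0 ≤ κ) (hu : ∀ l, MemLp (fun ω => u ω l) 2 μ)
    (h2 : ∀ l, ∫ ω, u ω l ^ 2 ∂μ ≤ κ) (l l' : δ) : |secondMoment μ u l l'| ≤ κ := by
  refine abs_le_of_sq_le_sq ((sq_integral_mul_le (hu l) (hu l')).trans ?_) hκ
  rw [sq κ]
  exact mul_le_mul (h2 l) (h2 l') (integral_nonneg fun ω => sq_nonneg _) hκ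

variable [Fintype δ]

lemma memLp_two_dotProduct (hu : ∀ l, MemLp (fun ω => u ω l) 2 μ) (x : δ → ℝ) :
    MemLp (fun ω => x ⬝ᵥ u ω) 2 μ :=
  memLp_finsetSum _ fun l _ => (hu l).const_mul (x l)

lemma dotProduct_secondMoment_mulVec (hu : ∀ l, MemLp (fun ω => u ω l) 2 μ) (x y : δ → ℝ) :
    x ⬝ᵥ secondMoment μ u *ᵥ y = ∫ ω, (x ⬝ᵥ u ω) * (y ⬝ᵥ u ω) ∂μ := by
  have integrable_mul (l l' : δ) : Integrable (fun ω => x l * u ω l * (y l' * u ω l')) μ :=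
    ((hu l).const_mul (x l)).integrable_mul ((hu l').const_mul (y l'))
  simp only [dotProduct, Finset.sum_mul_sum]
  rw [integral_finsetSum _ fun l _ => integrable_finsetSum _ fun l' _ => integrable_mul l l']
  refine Finset.sum_congr rfl fun l _ => ?_
  rw [integral_finsetSum _ fun l' _ => integrable_mul l l', Matrix.mulVec, dotProduct,
    Finset.mul_sum]
  refine Finset.sum_congr rfl fun l' _ => ?_
  rw [secondMoment, Matrix.of_apply, ← integral_mul_const, ← integral_const_mul]
  exact integral_congr_ae (.of_forall fun ω => by ring)

lemma dotProduct_secondMoment_mulVec_self_nonneg (hu : ∀ l, MemLp (fun ω => u ω l) 2 μ)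
    (x : δ → ℝ) : 0 ≤ x ⬝ᵥ secondMoment μ u *ᵥ x := by
  rw [dotProduct_secondMoment_mulVec hu]
  exact integral_nonneg fun ω => mul_self_nonneg _

lemma secondMoment_mulVec_sq_le (hu : ∀ l, MemLp (fun ω => u ω l) 2 μ) {κ : ℝ}
    (h2 : ∀ l, ∫ ω, u ω l ^ 2 ∂μ ≤ κ) (x : δ → ℝ) (l : δ) :
    (secondMoment μ u *ᵥ x) l ^ 2 ≤ κ * (x ⬝ᵥ secondMoment μ u *ᵥ x) := by
  classical
  have mulVec_eq : (secondMoment μ u *ᵥ x) l = ∫ ω, u ω l * (x ⬝ᵥ u ω) ∂μ := by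
    simpa using dotProduct_secondMoment_mulVec hu (Pi.single l 1) x
  rw [mulVec_eq, dotProduct_secondMoment_mulVec hu]
  simp only [← sq]
  refine (sq_integral_mul_le (hu l) (memLp_two_dotProduct hu x)).trans ?_
  gcongr
  exact h2 l

lemma dotProduct_mulVec_add_self {S : Matrix δ δ ℝ} (hS : S.IsSymm) (x y : δ → ℝ) :
    (x + y) ⬝ᵥ S *ᵥ (x + y) = x ⬝ᵥ S *ᵥ x + (2 * ((S *ᵥ x) ⬝ᵥ y) + y ⬝ᵥ S *ᵥ y) := by
  have cross_symm : x ⬝ᵥ S *ᵥ y = (S *ᵥ x) ⬝ᵥ y := by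
    rw [Matrix.dotProduct_mulVec, ← Matrix.mulVec_transpose, hS.eq]
  rw [Matrix.mulVec_add, add_dotProduct, dotProduct_add, dotProduct_add, cross_symm,
    dotProduct_comm y]
  ring

end SecondMoment

section CenteredIndep

variable {Ω ι δ : Type*} {m : MeasurableSpace Ω} {μ : Measure Ω}

/-- Independent centered random vectors `v k`, all of whose coordinates have fourth moment at most
`κ ^ 2`; the square makes `κ` a bound on the second moments. -/
structure IsCenteredIndep (μ : Measure Ω) (v : ι → Ω → δ → ℝ) (κ : ℝ) : Prop where
  measurable : ∀ k, Measurable (v k)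
  indep : iIndepFun v μ
  nonneg : 0 ≤ κ
  memLp_four : ∀ k l, MemLp (fun ω => v k ω l) 4 μ
  integral_eq_zero : ∀ k l, ∫ ω, v k ω l ∂μ = 0
  integral_pow_four_le : ∀ k l, ∫ ω, v k ω l ^ 4 ∂μ ≤ κ ^ 2

namespace IsCenteredIndep

variable {v : ι → Ω → δ → ℝ} {κ : ℝ}

lemma measurable_apply (h : IsCenteredIndep μ v κ) (k : ι) (l : δ) :
    Measurable fun ω => v k ω l :=
  (measurable_pi_apply l).comp (h.measurable k)

lemma iIndepFun_apply (h : IsCenteredIndep μ v κ) (l : δ) : iIndepFun (fun k ω => v k ω l) μ :=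
  h.indep.comp _ fun _ => measurable_pi_apply l

lemma iIndepFun_prodMk (h : IsCenteredIndep μ v κ) (l l' : δ) :
    iIndepFun (fun k ω => (v k ω l, v k ω l')) μ :=
  h.indep.comp (fun _ u => (u l, u l')) fun _ =>
    (measurable_pi_apply l).prodMk (measurable_pi_apply l')

lemma memLp_two_dotProduct_mulVec [Fintype ι] (h : IsCenteredIndep μ v κ) (M : Matrix ι ι ℝ)
    (l l' : δ) : MemLp (fun ω => (fun k => v k ω l) ⬝ᵥ M *ᵥ fun k => v k ω l') 2 μ := by
  simp only [dotProduct, Matrix.mulVec, Finset.mul_sum]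
  exact memLp_finsetSum _ fun j _ => memLp_finsetSum _ fun k _ => by
    simpa only [mul_left_comm] using!
      (memLp_two_mul_of_memLp_four (h.memLp_four j l) (h.memLp_four k l')).const_mul (M j k)

variable [IsProbabilityMeasure μ]

lemma memLp_two (h : IsCenteredIndep μ v κ) (k : ι) (l : δ) : MemLp (fun ω => v k ω l) 2 μ :=
  (h.memLp_four k l).mono_exponent (by norm_num)

lemma integral_sq_le (h : IsCenteredIndep μ v κ) (k : ι) (l : δ) : ∫ ω, v k ω l ^ 2 ∂μ ≤ κ :=
  integral_sq_le_of_integral_pow_four_le (h.memLp_four k l) h.nonneg (h.integral_pow_four_le k l)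

variable [Fintype ι]

lemma memLp_two_dotProduct_apply (h : IsCenteredIndep μ v κ) (c : ι → ℝ) (l : δ) :
    MemLp (fun ω => c ⬝ᵥ fun k => v k ω l) 2 μ :=
  memLp_finsetSum _ fun k _ => (h.memLp_two k l).const_mul (c k)

lemma integral_dotProduct_apply (h : IsCenteredIndep μ v κ) (c : ι → ℝ) (l : δ) :
    ∫ ω, c ⬝ᵥ (fun k => v k ω l) ∂μ = 0 :=
  integral_sum_eq_zero (fun k => ((h.memLp_two k l).integrable (by norm_num)).const_mul (c k))
    (fun k => by rw [integral_const_mul, h.integral_eq_zero, mul_zero]) _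

lemma variance_dotProduct_apply_le (h : IsCenteredIndep μ v κ) (c : ι → ℝ) (l : δ) :
    Var[fun ω => c ⬝ᵥ fun k => v k ω l; μ] ≤ κ * ∑ k, c k ^ 2 :=
  (variance_le_expectation_sq (h.memLp_two_dotProduct_apply c l).1).trans
    (integral_sum_const_mul_sq_le (h.iIndepFun_apply l) (fun k => h.memLp_two k l)
      (fun k => h.integral_eq_zero k l) (fun k => h.integral_sq_le k l) c _)

lemma variance_dotProduct_mulVec_le (h : IsCenteredIndep μ v κ) (M : Matrix ι ι ℝ) (l l' : δ) :
    Var[fun ω => (fun k => v k ω l) ⬝ᵥ M *ᵥ fun k => v k ω l'; μ] ≤ 4 * κ ^ 2 * ‖M‖ ^ 2 := by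
  rw [frobenius_norm_sq]
  simpa only [dotProduct, Matrix.mulVec, Finset.mul_sum, mul_left_comm] using
    variance_sum_sum_mul_le (fun k => h.measurable_apply k l) (fun k => h.measurable_apply k l')
      (h.iIndepFun_prodMk l l') (fun k => h.memLp_four k l) (fun k => h.memLp_four k l')
      (fun k => h.integral_eq_zero k l) (fun k => h.integral_eq_zero k l') h.nonneg
      (fun k => h.integral_pow_four_le k l) (fun k => h.integral_pow_four_le k l') M Finset.univ

end IsCenteredIndep

end CenteredIndep

section LinearWeight

variable {Ω ι δ : Type*} {m : MeasurableSpace Ω} {μ : Measure Ω} [Fintype ι] [Fintype δ]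

/-- The random vector `∑ j, B k j v j`, where `b l l' k j` is the `(l, l')` entry of the matrix
`B k j`; ordering the indices this way makes each `b l l'` a matrix with norm `‖b l l'‖`. -/
def linearWeight (b : δ → δ → Matrix ι ι ℝ) (v : ι → Ω → δ → ℝ) (k : ι) (ω : Ω) : δ → ℝ :=
  fun l => ∑ l', (b l l' *ᵥ fun j => v j ω l') k

lemma sum_dotProduct_linearWeight (r : ι → δ → ℝ) (b : δ → δ → Matrix ι ι ℝ)
    (v : ι → Ω → δ → ℝ) (ω : Ω) : ∑ k, r k ⬝ᵥ linearWeight b v k ω =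
      ∑ p : δ × δ, ((fun k => r k p.1) ᵥ* b p.1 p.2) ⬝ᵥ fun j => v j ω p.2 := by
  simp only [← Matrix.dotProduct_mulVec, Fintype.sum_prod_type]
  simp only [dotProduct, linearWeight, Finset.mul_sum]
  rw [Finset.sum_comm]
  exact Finset.sum_congr rfl fun l _ => Finset.sum_comm

lemma sum_linearWeight_dotProduct_mulVec [DecidableEq ι] (S : ι → Matrix δ δ ℝ)
    (b : δ → δ → Matrix ι ι ℝ) (v : ι → Ω → δ → ℝ) (ω : Ω) :
    ∑ k, linearWeight b v k ω ⬝ᵥ S k *ᵥ linearWeight b v k ω =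
      ∑ p : (δ × δ) × (δ × δ), (fun j => v j ω p.1.2) ⬝ᵥ
        ((b p.1.1 p.1.2)ᵀ * (Matrix.diagonal (fun k => S k p.1.1 p.2.1) * b p.2.1 p.2.2)) *ᵥ
          fun j => v j ω p.2.2 := by
  have term_eq (p : (δ × δ) × (δ × δ)) : (fun j => v j ω p.1.2) ⬝ᵥ
      ((b p.1.1 p.1.2)ᵀ * (Matrix.diagonal (fun k => S k p.1.1 p.2.1) * b p.2.1 p.2.2)) *ᵥ
        (fun j => v j ω p.2.2) = ∑ k, (b p.1.1 p.1.2 *ᵥ fun j => v j ω p.1.2) k *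
          (S k p.1.1 p.2.1 * (b p.2.1 p.2.2 *ᵥ fun j => v j ω p.2.2) k) := by
    rw [← Matrix.mulVec_mulVec, Matrix.dotProduct_mulVec, Matrix.vecMul_transpose,
      ← Matrix.mulVec_mulVec]
    simp only [dotProduct, Matrix.mulVec_diagonal]
  simp only [term_eq]
  rw [Finset.sum_comm]
  refine Finset.sum_congr rfl fun k _ => ?_
  simp only [Fintype.sum_prod_type, dotProduct, Matrix.mulVec.eq_def (S k), linearWeight,
    Finset.sum_mul, Finset.mul_sum]
  exact Finset.sum_congr rfl fun l _ =>
    (Finset.sum_congr rfl fun _ _ => Finset.sum_comm).trans Finset.sum_comm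

variable {v : ι → Ω → δ → ℝ} {κ γ : ℝ} {b : δ → δ → Matrix ι ι ℝ}

lemma memLp_two_sum_linearWeight_dotProduct_mulVec (h : IsCenteredIndep μ v κ)
    (S : ι → Matrix δ δ ℝ) :
    MemLp (fun ω => ∑ k, linearWeight b v k ω ⬝ᵥ S k *ᵥ linearWeight b v k ω) 2 μ := by
  classical
  simp only [sum_linearWeight_dotProduct_mulVec]
  exact memLp_finsetSum _ fun p _ => h.memLp_two_dotProduct_mulVec _ p.1.2 p.2.2

variable [IsProbabilityMeasure μ]

lemma memLp_two_sum_dotProduct_linearWeight (h : IsCenteredIndep μ v κ) (r : ι → δ → ℝ) :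
    MemLp (fun ω => ∑ k, r k ⬝ᵥ linearWeight b v k ω) 2 μ := by
  simp only [sum_dotProduct_linearWeight]
  exact memLp_finsetSum _ fun p _ => h.memLp_two_dotProduct_apply _ p.2

lemma integral_sum_dotProduct_linearWeight (h : IsCenteredIndep μ v κ) (r : ι → δ → ℝ) :
    ∫ ω, ∑ k, r k ⬝ᵥ linearWeight b v k ω ∂μ = 0 := by
  simp only [sum_dotProduct_linearWeight]
  exact integral_sum_eq_zero
    (fun p : δ × δ => (h.memLp_two_dotProduct_apply _ p.2).integrable (by norm_num))
    (fun p => h.integral_dotProduct_apply _ p.2) _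

lemma variance_sum_dotProduct_linearWeight_le (h : IsCenteredIndep μ v κ)
    (hγ : ∀ l l', ‖b l l' * (b l l')ᵀ‖ ≤ γ) (r : ι → δ → ℝ) :
    Var[fun ω => ∑ k, r k ⬝ᵥ linearWeight b v k ω; μ] ≤
      Fintype.card δ ^ 3 * (κ * γ * ∑ k, ∑ l, r k l ^ 2) := by
  simp only [sum_dotProduct_linearWeight]
  refine (variance_sum_le _ fun p _ => h.memLp_two_dotProduct_apply _ p.2).trans ?_
  have hκ := h.nonneg
  calc _ ≤ ((Finset.univ : Finset (δ × δ)).card : ℝ) *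
        ∑ p : δ × δ, κ * (γ * ∑ k, r k p.1 ^ 2) := by
        gcongr with p
        refine (h.variance_dotProduct_apply_le _ p.2).trans ?_
        gcongr
        exact (sum_vecMul_sq_le _ _).trans (by gcongr; exact hγ p.1 p.2)
    _ = Fintype.card δ ^ 3 * (κ * γ * ∑ k, ∑ l, r k l ^ 2) := by
        rw [Fintype.sum_prod_type, Finset.sum_comm (s := (Finset.univ : Finset ι))]
        simp only [Finset.sum_const, Finset.card_univ, Fintype.card_prod, nsmul_eq_mul,
          ← Finset.mul_sum]
        push_cast
        ring

lemma variance_sum_linearWeight_dotProduct_mulVec_le (h : IsCenteredIndep μ v κ)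
    (hγ : ∀ l l', ‖b l l' * (b l l')ᵀ‖ ≤ γ) {S : ι → Matrix δ δ ℝ} {c : ℝ}
    (hS : ∀ k l l', |S k l l'| ≤ c) :
    Var[fun ω => ∑ k, linearWeight b v k ω ⬝ᵥ S k *ᵥ linearWeight b v k ω; μ] ≤
      Fintype.card δ ^ 8 * (4 * κ ^ 2 * (c ^ 2 * γ ^ 2)) := by
  classical
  simp only [sum_linearWeight_dotProduct_mulVec]
  refine (variance_sum_le _ fun p _ => h.memLp_two_dotProduct_mulVec _ p.1.2 p.2.2).trans ?_
  calc _ ≤ ((Finset.univ : Finset ((δ × δ) × (δ × δ))).card : ℝ) *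
        ∑ p : (δ × δ) × (δ × δ), 4 * κ ^ 2 * (γ * (c ^ 2 * γ)) := by
        gcongr with p
        refine (h.variance_dotProduct_mulVec_le _ p.1.2 p.2.2).trans ?_
        gcongr
        refine (frobenius_norm_transpose_mul_sq_le _ _).trans ?_
        have gram_le := (frobenius_norm_diagonal_mul_gram_le (fun k => hS k p.1.1 p.2.1)
          (b p.2.1 p.2.2)).trans (mul_le_mul_of_nonneg_left (hγ p.2.1 p.2.2) (sq_nonneg c))
        exact mul_le_mul (hγ p.1.1 p.1.2) gram_le (norm_nonneg _)
          ((norm_nonneg _).trans (hγ p.1.1 p.1.2))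
    _ = Fintype.card δ ^ 8 * (4 * κ ^ 2 * (c ^ 2 * γ ^ 2)) := by
        simp only [Finset.sum_const, Finset.card_univ, Fintype.card_prod, nsmul_eq_mul]
        push_cast
        ring

end LinearWeight

section WeightedDiff

variable {Ω ι δ : Type*} {m : MeasurableSpace Ω} {μ : Measure Ω} [Fintype ι] [Fintype δ]

/-- The summand `w k' v k` with weight `w k = s k + ∑ j, B k j v j`; it is a martingale difference
when `B k j` vanishes for `k ≤ j`. -/
def weightedDiff (s : ι → δ → ℝ) (b : δ → δ → Matrix ι ι ℝ) (v : ι → Ω → δ → ℝ) (k : ι) (ω : Ω) :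
    ℝ :=
  (s k + linearWeight b v k ω) ⬝ᵥ v k ω

/-- The conditional variance of `weightedDiff s b v k` given the variables in its weight, when these
are independent of `v k`. -/
noncomputable def weightedDiffCondVar (μ : Measure Ω) (s : ι → δ → ℝ) (b : δ → δ → Matrix ι ι ℝ)
    (v : ι → Ω → δ → ℝ) (k : ι) (ω : Ω) : ℝ :=
  (s k + linearWeight b v k ω) ⬝ᵥ secondMoment μ (v k) *ᵥ (s k + linearWeight b v k ω)

lemma sum_weightedDiffCondVar (s : ι → δ → ℝ) (b : δ → δ → Matrix ι ι ℝ) (v : ι → Ω → δ → ℝ)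
    (ω : Ω) : ∑ k, weightedDiffCondVar μ s b v k ω =
      ∑ k, s k ⬝ᵥ secondMoment μ (v k) *ᵥ s k +
        (2 * ∑ k, (secondMoment μ (v k) *ᵥ s k) ⬝ᵥ linearWeight b v k ω +
          ∑ k, linearWeight b v k ω ⬝ᵥ secondMoment μ (v k) *ᵥ linearWeight b v k ω) := by
  simp only [weightedDiffCondVar, dotProduct_mulVec_add_self isSymm_secondMoment,
    Finset.sum_add_distrib, Finset.mul_sum]

variable {s : ι → δ → ℝ} {v : ι → Ω → δ → ℝ} {κ γ : ℝ} {b : δ → δ → Matrix ι ι ℝ}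
  [IsProbabilityMeasure μ]

lemma memLp_two_linear_add_quadratic (h : IsCenteredIndep μ v κ) : MemLp (fun ω =>
    2 * ∑ k, (secondMoment μ (v k) *ᵥ s k) ⬝ᵥ linearWeight b v k ω +
      ∑ k, linearWeight b v k ω ⬝ᵥ secondMoment μ (v k) *ᵥ linearWeight b v k ω) 2 μ :=
  have linear_memLp := (memLp_two_sum_dotProduct_linearWeight (b := b) h
    fun k => secondMoment μ (v k) *ᵥ s k).const_mul 2
  have quadratic_memLp := memLp_two_sum_linearWeight_dotProduct_mulVec (b := b) h
    fun k => secondMoment μ (v k)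
  linear_memLp.add quadratic_memLp

lemma memLp_two_sum_weightedDiffCondVar (h : IsCenteredIndep μ v κ) :
    MemLp (fun ω => ∑ k, weightedDiffCondVar μ s b v k ω) 2 μ := by
  simp only [sum_weightedDiffCondVar]
  exact (memLp_const (∑ k, s k ⬝ᵥ secondMoment μ (v k) *ᵥ s k)).add
    (memLp_two_linear_add_quadratic h)

lemma sum_dotProduct_secondMoment_mulVec_le (h : IsCenteredIndep μ v κ) :
    ∑ k, s k ⬝ᵥ secondMoment μ (v k) *ᵥ s k ≤
      ∫ ω, ∑ k, weightedDiffCondVar μ s b v k ω ∂μ := by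
  have integrable_linear :
      Integrable (fun ω => 2 * ∑ k, (secondMoment μ (v k) *ᵥ s k) ⬝ᵥ linearWeight b v k ω) μ :=
    ((memLp_two_sum_dotProduct_linearWeight h _).integrable (by norm_num)).const_mul 2
  have integrable_quadratic := (memLp_two_sum_linearWeight_dotProduct_mulVec (b := b) h
    fun k => secondMoment μ (v k)).integrable (by norm_num)
  simp only [sum_weightedDiffCondVar]
  rw [integral_add (integrable_const _) (integrable_linear.fun_add integrable_quadratic),
    integral_add integrable_linear integrable_quadratic, integral_const_mul,
    integral_sum_dotProduct_linearWeight h, integral_const, probReal_univ, one_smul, mul_zero,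
    zero_add]
  exact le_add_of_nonneg_right (integral_nonneg fun ω => Finset.sum_nonneg fun k _ =>
    dotProduct_secondMoment_mulVec_self_nonneg (h.memLp_two k) _)

lemma sum_secondMoment_mulVec_sq_le (h : IsCenteredIndep μ v κ) :
    ∑ k, ∑ l, (secondMoment μ (v k) *ᵥ s k) l ^ 2 ≤
      Fintype.card δ * (κ * ∑ k, s k ⬝ᵥ secondMoment μ (v k) *ᵥ s k) := by
  rw [Finset.mul_sum, Finset.mul_sum]
  refine Finset.sum_le_sum fun k _ => ?_
  rw [← nsmul_eq_mul]
  exact Finset.sum_le_card_nsmul _ _ _ fun l _ =>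
    secondMoment_mulVec_sq_le (h.memLp_two k) (h.integral_sq_le k) (s k) l

lemma variance_sum_weightedDiffCondVar_le (h : IsCenteredIndep μ v κ) (hγ0 : 0 ≤ γ)
    (hγ : ∀ l l', ‖b l l' * (b l l')ᵀ‖ ≤ γ) :
    Var[fun ω => ∑ k, weightedDiffCondVar μ s b v k ω; μ] ≤
      8 * (Fintype.card δ ^ 4 * (κ ^ 2 * γ * ∫ ω, ∑ k, weightedDiffCondVar μ s b v k ω ∂μ) +
        Fintype.card δ ^ 8 * (κ ^ 4 * γ ^ 2)) := by
  have hκ := h.nonneg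
  have linear_memLp := memLp_two_sum_dotProduct_linearWeight (b := b) h
    fun k => secondMoment μ (v k) *ᵥ s k
  have quadratic_memLp := memLp_two_sum_linearWeight_dotProduct_mulVec (b := b) h
    fun k => secondMoment μ (v k)
  have var_linear : Var[fun ω => ∑ k, (secondMoment μ (v k) *ᵥ s k) ⬝ᵥ linearWeight b v k ω; μ] ≤
      Fintype.card δ ^ 4 * (κ ^ 2 * γ * ∫ ω, ∑ k, weightedDiffCondVar μ s b v k ω ∂μ) := by
    refine (variance_sum_dotProduct_linearWeight_le h hγ _).trans ?_
    have sum_sq_le := (sum_secondMoment_mulVec_sq_le (s := s) h).trans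
      (mul_le_mul_of_nonneg_left (mul_le_mul_of_nonneg_left
        (sum_dotProduct_secondMoment_mulVec_le (b := b) h) hκ) (Nat.cast_nonneg _))
    refine (mul_le_mul_of_nonneg_left (mul_le_mul_of_nonneg_left sum_sq_le
      (mul_nonneg hκ hγ0)) (by positivity)).trans_eq ?_
    ring
  have var_quadratic := variance_sum_linearWeight_dotProduct_mulVec_le h hγ
    fun k => abs_secondMoment_le hκ (h.memLp_two k) (h.integral_sq_le k)
  simp only [sum_weightedDiffCondVar (μ := μ)] at var_linear ⊢
  rw [variance_const_add (memLp_two_linear_add_quadratic h).1]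
  refine (variance_add_le (linear_memLp.const_mul 2) quadratic_memLp).trans ?_
  rw [variance_const_mul]
  linarith

end WeightedDiff

section CondExp

variable {Ω ι δ : Type*} {m : MeasurableSpace Ω} {μ : Measure Ω}

lemma memLp_four_mul_of_indepFun {f g : Ω → ℝ} (h : IndepFun f g μ) (hf : MemLp f 4 μ)
    (hg : MemLp g 4 μ) : MemLp (fun ω => f ω * g ω) 4 μ := by
  refine (memLp_four_iff_integrable_pow (hf.1.mul hg.1)).2 ?_
  simpa only [Pi.mul_apply, mul_pow] using! IndepFun.integrable_mul
    (h.comp (measurable_id.pow_const 4) (measurable_id.pow_const 4))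
    ((memLp_four_iff_integrable_pow hf.1).1 hf) ((memLp_four_iff_integrable_pow hg.1).1 hg)

lemma integral_mul_pow_four_of_indepFun {f g : Ω → ℝ} (h : IndepFun f g μ)
    (hf : AEStronglyMeasurable f μ) (hg : AEStronglyMeasurable g μ) :
    ∫ ω, (f ω * g ω) ^ 4 ∂μ = (∫ ω, f ω ^ 4 ∂μ) * ∫ ω, g ω ^ 4 ∂μ := by
  simp only [mul_pow]
  exact IndepFun.integral_fun_mul_eq_mul_integral
    (h.comp (measurable_id.pow_const 4) (measurable_id.pow_const 4)) (hf.pow 4) (hg.pow 4)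

lemma condExp_sum_mul_of_indep [IsFiniteMeasure μ] {F G : MeasurableSpace Ω} (hF : F ≤ m)
    (hG : G ≤ m) (hGF : Indep G F μ) (S : Finset ι) {f g : ι → Ω → ℝ}
    (hf : ∀ i, StronglyMeasurable[F] (f i)) (hg : ∀ i, StronglyMeasurable[G] (g i))
    (hfg : ∀ i, Integrable (fun ω => f i ω * g i ω) μ) (hgi : ∀ i, Integrable (g i) μ) :
    μ[fun ω => ∑ i ∈ S, f i ω * g i ω | F] =ᵐ[μ] fun ω => ∑ i ∈ S, f i ω * ∫ ω', g i ω' ∂μ := by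
  have condExp_mul (i : ι) :
      μ[fun ω => f i ω * g i ω | F] =ᵐ[μ] fun ω => f i ω * ∫ ω', g i ω' ∂μ := by
    filter_upwards [condExp_mul_of_stronglyMeasurable_left (hf i) (hfg i) (hgi i),
      condExp_indep_eq hG hF (hg i) hGF] with ω pull_out indep_eq
    exact pull_out.trans (by rw [Pi.mul_apply, indep_eq])
  have condExp_sum := condExp_finsetSum (s := S) (fun i _ => hfg i) F
  rw [Finset.sum_fn] at condExp_sum
  filter_upwards [condExp_sum, (ae_ball_iff S.countable_toSet).2 fun i _ => condExp_mul i]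
    with ω sum_eq mul_eq
  rw [sum_eq, Finset.sum_apply]
  exact Finset.sum_congr rfl mul_eq

lemma indep_comap_generatedBy_Iio [LinearOrder ι] {v : ι → Ω → δ → ℝ} {κ : ℝ} {k : ι}
    (h : IsCenteredIndep μ v κ) :
    Indep (MeasurableSpace.pi.comap (v k)) (generatedBy v (Set.Iio k)) μ :=
  (indep_generatedBy_comap h.measurable h.indep Set.self_notMem_Iio).symm

lemma stronglyMeasurable_comap_apply {v : Ω → δ → ℝ} (l : δ) :
    StronglyMeasurable[MeasurableSpace.pi.comap v] fun ω => v ω l :=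
  ((measurable_pi_apply l).comp (comap_measurable v)).stronglyMeasurable

variable [Fintype ι] [Fintype δ] {s : ι → δ → ℝ} {v : ι → Ω → δ → ℝ} {κ γ : ℝ}
  {b : δ → δ → Matrix ι ι ℝ} {k : ι}

lemma memLp_four_linearWeight (h : IsCenteredIndep μ v κ) (l : δ) :
    MemLp (fun ω => linearWeight b v k ω l) 4 μ :=
  memLp_finsetSum _ fun l' _ => memLp_finsetSum _ fun j _ => (h.memLp_four j l').const_mul _

lemma memLp_four_weight [IsProbabilityMeasure μ] (h : IsCenteredIndep μ v κ) (l : δ) :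
    MemLp (fun ω => (s k + linearWeight b v k ω) l) 4 μ :=
  (memLp_const (s k l)).add (memLp_four_linearWeight h l)

variable [LinearOrder ι]

lemma measurable_weight (hb : ∀ l l' k j, k ≤ j → b l l' k j = 0) (l : δ) :
    Measurable[generatedBy v (Set.Iio k)] fun ω => (s k + linearWeight b v k ω) l := by
  refine measurable_const.add (Finset.measurable_fun_sum _ fun l' _ =>
    Finset.measurable_fun_sum _ fun j _ => ?_)
  rcases le_or_gt k j with hkj | hjk
  · simp only [hb l l' k j hkj, zero_mul]
    exact measurable_const
  · exact ((measurable_pi_apply l').comp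
      (measurable_generatedBy v (S := Set.Iio k) hjk)).const_mul (b l l' k j)

lemma indepFun_weight (h : IsCenteredIndep μ v κ) (hb : ∀ l l' k j, k ≤ j → b l l' k j = 0)
    (l l' : δ) : IndepFun (fun ω => (s k + linearWeight b v k ω) l) (fun ω => v k ω l') μ :=
  (indepFun_of_measurable_generatedBy h.measurable h.indep Set.self_notMem_Iio
    (measurable_weight hb l)).comp measurable_id (measurable_pi_apply l')

variable [IsProbabilityMeasure μ]

lemma memLp_four_weight_mul (h : IsCenteredIndep μ v κ)
    (hb : ∀ l l' k j, k ≤ j → b l l' k j = 0) (l : δ) :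
    MemLp (fun ω => (s k + linearWeight b v k ω) l * v k ω l) 4 μ :=
  memLp_four_mul_of_indepFun (indepFun_weight h hb l l) (memLp_four_weight h l) (h.memLp_four k l)

lemma memLp_four_weightedDiff (h : IsCenteredIndep μ v κ)
    (hb : ∀ l l' k j, k ≤ j → b l l' k j = 0) : MemLp (weightedDiff s b v k) 4 μ :=
  memLp_finsetSum _ fun l _ => memLp_four_weight_mul h hb l

lemma condExp_weightedDiff (h : IsCenteredIndep μ v κ)
    (hb : ∀ l l' k j, k ≤ j → b l l' k j = 0) :
    μ[weightedDiff s b v k | generatedBy v (Set.Iio k)] =ᵐ[μ] 0 := by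
  refine (condExp_sum_mul_of_indep (generatedBy_le h.measurable _) (h.measurable k).comap_le
    (indep_comap_generatedBy_Iio h) Finset.univ
    (fun l => (measurable_weight hb l).stronglyMeasurable) stronglyMeasurable_comap_apply
    (fun l => (memLp_four_weight_mul h hb l).integrable (by norm_num))
    (fun l => (h.memLp_two k l).integrable (by norm_num))).trans ?_
  exact .of_forall fun ω => by simp [h.integral_eq_zero]

lemma condExp_weightedDiff_sq (h : IsCenteredIndep μ v κ)
    (hb : ∀ l l' k j, k ≤ j → b l l' k j = 0) :
    μ[fun ω => weightedDiff s b v k ω ^ 2 | generatedBy v (Set.Iio k)] =ᵐ[μ]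
      weightedDiffCondVar μ s b v k := by
  have sq_eq (ω : Ω) : weightedDiff s b v k ω ^ 2 = ∑ p : δ × δ,
      ((s k + linearWeight b v k ω) p.1 * (s k + linearWeight b v k ω) p.2) *
        (v k ω p.1 * v k ω p.2) := by
    rw [weightedDiff, dotProduct, sq, Finset.sum_mul_sum, Fintype.sum_prod_type]
    exact Finset.sum_congr rfl fun l _ => Finset.sum_congr rfl fun l' _ => by ring
  have integrable_term (p : δ × δ) : Integrable (fun ω =>
      ((s k + linearWeight b v k ω) p.1 * (s k + linearWeight b v k ω) p.2) *
        (v k ω p.1 * v k ω p.2)) μ := by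
    convert! (memLp_two_mul_of_memLp_four (memLp_four_weight_mul h hb p.1)
      (memLp_four_weight_mul h hb p.2)).integrable (by norm_num) using 2 with ω
    ring
  simp only [sq_eq]
  refine (condExp_sum_mul_of_indep (generatedBy_le h.measurable _) (h.measurable k).comap_le
    (indep_comap_generatedBy_Iio h) Finset.univ
    (fun p : δ × δ => ((measurable_weight hb p.1).mul
      (measurable_weight hb p.2)).stronglyMeasurable)
    (fun p => (stronglyMeasurable_comap_apply p.1).mul (stronglyMeasurable_comap_apply p.2))
    integrable_term fun p => (memLp_two_mul_of_memLp_four (h.memLp_four k p.1)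
      (h.memLp_four k p.2)).integrable (by norm_num)).trans (.of_forall fun ω => ?_)
  simp only [weightedDiffCondVar, dotProduct, Matrix.mulVec, Finset.mul_sum, secondMoment,
    Matrix.of_apply, Fintype.sum_prod_type, Pi.mul_apply]
  exact Finset.sum_congr rfl fun l _ => Finset.sum_congr rfl fun l' _ => by ring

end CondExp

section FourthMoment

variable {Ω ι δ : Type*} {m : MeasurableSpace Ω} {μ : Measure Ω} [Fintype ι] [Fintype δ]
  [IsProbabilityMeasure μ] {s : ι → δ → ℝ} {v : ι → Ω → δ → ℝ} {κ γ : ℝ}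
  {b : δ → δ → Matrix ι ι ℝ} {k : ι}

lemma integral_linearWeight_pow_four_le (h : IsCenteredIndep μ v κ) (l : δ) :
    ∫ ω, linearWeight b v k ω l ^ 4 ∂μ ≤
      Fintype.card δ ^ 3 * ∑ l', 3 * (κ * ∑ j, b l l' k j ^ 2) ^ 2 := by
  have memLp_row (l' : δ) : MemLp (fun ω => ∑ j, b l l' k j * v j ω l') 4 μ :=
    memLp_finsetSum _ fun j _ => (h.memLp_four j l').const_mul _
  have integrable_row (l' : δ) : Integrable (fun ω => (∑ j, b l l' k j * v j ω l') ^ 4) μ :=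
    (memLp_four_iff_integrable_pow (memLp_row l').1).1 (memLp_row l')
  calc ∫ ω, linearWeight b v k ω l ^ 4 ∂μ
      ≤ ∫ ω, (Fintype.card δ : ℝ) ^ 3 * ∑ l', (∑ j, b l l' k j * v j ω l') ^ 4 ∂μ :=
        integral_mono
          ((memLp_four_iff_integrable_pow (memLp_four_linearWeight h l).1).1
            (memLp_four_linearWeight h l))
          ((integrable_finsetSum _ fun l' _ => integrable_row l').const_mul _)
          fun ω => pow_four_sum_le Finset.univ fun l' => ∑ j, b l l' k j * v j ω l'
    _ = Fintype.card δ ^ 3 * ∑ l', ∫ ω, (∑ j, b l l' k j * v j ω l') ^ 4 ∂μ := by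
        rw [integral_const_mul, integral_finsetSum _ fun l' _ => integrable_row l']
    _ ≤ _ := mul_le_mul_of_nonneg_left (Finset.sum_le_sum fun l' _ =>
        integral_sum_const_mul_pow_four_le (h.iIndepFun_apply l') (fun j => h.memLp_four j l')
          (fun j => h.integral_eq_zero j l') h.nonneg (fun j => h.integral_pow_four_le j l')
          (b l l' k) Finset.univ) (by positivity)

lemma integral_weight_pow_four_le (h : IsCenteredIndep μ v κ) (l : δ) :
    ∫ ω, (s k + linearWeight b v k ω) l ^ 4 ∂μ ≤
      8 * (s k l ^ 4 + Fintype.card δ ^ 3 * ∑ l', 3 * (κ * ∑ j, b l l' k j ^ 2) ^ 2) := by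
  have integrable_linear : Integrable (fun ω => linearWeight b v k ω l ^ 4) μ :=
    (memLp_four_iff_integrable_pow (memLp_four_linearWeight h l).1).1 (memLp_four_linearWeight h l)
  calc ∫ ω, (s k + linearWeight b v k ω) l ^ 4 ∂μ
      ≤ ∫ ω, 8 * (s k l ^ 4 + linearWeight b v k ω l ^ 4) ∂μ :=
        integral_mono ((memLp_four_iff_integrable_pow (memLp_four_weight h l).1).1
          (memLp_four_weight h l)) (((integrable_const _).add integrable_linear).const_mul _)
          fun ω => (Even.add_pow_le ⟨2, rfl⟩).trans_eq (by norm_num)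
    _ = 8 * (s k l ^ 4 + ∫ ω, linearWeight b v k ω l ^ 4 ∂μ) := by
        rw [integral_const_mul, integral_add (integrable_const _) integrable_linear,
          integral_const, probReal_univ, one_smul]
    _ ≤ _ := by
        have := integral_linearWeight_pow_four_le (b := b) (k := k) h l
        linarith

variable [LinearOrder ι]

lemma integral_weightedDiff_pow_four_le (h : IsCenteredIndep μ v κ)
    (hb : ∀ l l' k j, k ≤ j → b l l' k j = 0) :
    ∫ ω, weightedDiff s b v k ω ^ 4 ∂μ ≤
      Fintype.card δ ^ 3 * ∑ l, 8 * (s k l ^ 4 +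
        Fintype.card δ ^ 3 * ∑ l', 3 * (κ * ∑ j, b l l' k j ^ 2) ^ 2) * κ ^ 2 := by
  have integrable_term (l : δ) :
      Integrable (fun ω => ((s k + linearWeight b v k ω) l * v k ω l) ^ 4) μ :=
    (memLp_four_iff_integrable_pow (memLp_four_weight_mul h hb l).1).1
      (memLp_four_weight_mul h hb l)
  calc ∫ ω, weightedDiff s b v k ω ^ 4 ∂μ
      ≤ ∫ ω, (Fintype.card δ : ℝ) ^ 3 *
          ∑ l, ((s k + linearWeight b v k ω) l * v k ω l) ^ 4 ∂μ :=
        integral_mono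
          ((memLp_four_iff_integrable_pow (memLp_four_weightedDiff h hb).1).1
            (memLp_four_weightedDiff h hb))
          ((integrable_finsetSum _ fun l _ => integrable_term l).const_mul _)
          fun ω => pow_four_sum_le Finset.univ fun l => (s k + linearWeight b v k ω) l * v k ω l
    _ = Fintype.card δ ^ 3 * ∑ l, (∫ ω, (s k + linearWeight b v k ω) l ^ 4 ∂μ) *
          ∫ ω, v k ω l ^ 4 ∂μ := by
        rw [integral_const_mul, integral_finsetSum _ fun l _ => integrable_term l]
        exact congrArg _ (Finset.sum_congr rfl fun l _ => integral_mul_pow_four_of_indepFun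
          (indepFun_weight h hb l l) (memLp_four_weight h l).1 (h.memLp_four k l).1)
    _ ≤ _ := mul_le_mul_of_nonneg_left (Finset.sum_le_sum fun l _ =>
        mul_le_mul (integral_weight_pow_four_le h l) (h.integral_pow_four_le k l)
          (by positivity) (by positivity)) (by positivity)

lemma sum_integral_weightedDiff_pow_four_le (h : IsCenteredIndep μ v κ)
    (hb : ∀ l l' k j, k ≤ j → b l l' k j = 0) (hγ : ∀ l l', ‖b l l' * (b l l')ᵀ‖ ≤ γ) :
    ∑ k, ∫ ω, weightedDiff s b v k ω ^ 4 ∂μ ≤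
      8 * Fintype.card δ ^ 3 * κ ^ 2 *
        (∑ l, ∑ k, s k l ^ 4 + 3 * Fintype.card δ ^ 5 * κ ^ 2 * γ ^ 2) := by
  have sum_row_le (l l' : δ) : ∑ k, (∑ j, b l l' k j ^ 2) ^ 2 ≤ γ ^ 2 :=
    (sum_sq_sum_row_sq_le (b l l')).trans (pow_le_pow_left₀ (norm_nonneg _) (hγ l l') 2)
  calc ∑ k, ∫ ω, weightedDiff s b v k ω ^ 4 ∂μ
      ≤ ∑ k, (Fintype.card δ : ℝ) ^ 3 * ∑ l, 8 * (s k l ^ 4 +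
          Fintype.card δ ^ 3 * ∑ l', 3 * (κ * ∑ j, b l l' k j ^ 2) ^ 2) * κ ^ 2 :=
        Finset.sum_le_sum fun k _ => integral_weightedDiff_pow_four_le h hb
    _ = 8 * Fintype.card δ ^ 3 * κ ^ 2 * (∑ l, ∑ k, s k l ^ 4 +
          3 * Fintype.card δ ^ 3 * κ ^ 2 * ∑ l, ∑ l', ∑ k, (∑ j, b l l' k j ^ 2) ^ 2) := by
        have sum_comm : ∑ l, ∑ l', ∑ k, (∑ j, b l l' k j ^ 2) ^ 2 =
            ∑ k, ∑ l, ∑ l', (∑ j, b l l' k j ^ 2) ^ 2 :=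
          (Finset.sum_congr rfl fun l _ => Finset.sum_comm).trans Finset.sum_comm
        rw [sum_comm, Finset.sum_comm (f := fun l k => s k l ^ 4)]
        simp only [mul_pow, ← Finset.sum_mul, ← Finset.mul_sum, Finset.sum_add_distrib]
        ring
    _ ≤ 8 * Fintype.card δ ^ 3 * κ ^ 2 * (∑ l, ∑ k, s k l ^ 4 +
          3 * Fintype.card δ ^ 3 * κ ^ 2 * ∑ _l : δ, ∑ _l' : δ, γ ^ 2) := by
        gcongr
        exact sum_row_le _ _
    _ = _ := by
        simp only [Finset.sum_const, Finset.card_univ, nsmul_eq_mul]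
        ring

end FourthMoment

section CentralLimit

lemma integral_abs_mul_sub_mul_integral_le {Ω : Type*} {m : MeasurableSpace Ω} {μ : Measure Ω}
    [IsProbabilityMeasure μ] {f : Ω → ℝ} (hf : MemLp f 2 μ) {a : ℝ} (ha : 0 ≤ a) :
    ∫ ω, |a * f ω - a * ∫ ω', f ω' ∂μ| ∂μ ≤ a * √Var[f; μ] := by
  simp only [← mul_sub, abs_mul, abs_of_nonneg ha, integral_const_mul]
  rw [variance_eq_integral hf.1.aemeasurable]
  exact mul_le_mul_of_nonneg_left
    (integral_abs_le_sqrt (hf.sub (memLp_const (∫ ω, f ω ∂μ)))) ha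

variable {Ω δ : Type*} {m : MeasurableSpace Ω} {n : ℕ}

/-- The information in the variables indexed below `N`; it stops growing at time `n`. -/
def pastFiltration {v : Fin n → Ω → δ → ℝ} (hv : ∀ j, Measurable (v j)) : Filtration ℕ m where
  seq N := generatedBy v {j | (j : ℕ) < N}
  mono' _ _ hN := generatedBy_mono v fun _ hj => lt_of_lt_of_le hj hN
  le' _ := generatedBy_le hv _

lemma sum_range_extend_val (f : Fin n → Ω → ℝ) (ω : Ω) :
    ∑ k ∈ Finset.range n, Function.extend Fin.val f 0 k ω = ∑ k, f k ω := by
  rw [← Fin.sum_univ_eq_sum_range fun k => Function.extend Fin.val f 0 k ω]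
  simp only [Fin.val_injective.extend_apply]

variable [Fintype δ] {μ : Measure Ω} {s : Fin n → δ → ℝ}
  {v : Fin n → Ω → δ → ℝ} {κ γ : ℝ} {b : δ → δ → Matrix (Fin n) (Fin n) ℝ} {k : Fin n}

lemma stronglyMeasurable_weightedDiff (hv : ∀ j, Measurable (v j))
    (hb : ∀ l l' k j, k ≤ j → b l l' k j = 0) :
    StronglyMeasurable[pastFiltration hv (k + 1)] (weightedDiff s b v k) :=
  Finset.stronglyMeasurable_fun_sum _ fun l _ =>
    (((measurable_weight hb l).stronglyMeasurable.mono
      ((pastFiltration hv).mono k.val.le_succ)).mul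
    ((measurable_pi_apply l).comp
      (measurable_generatedBy v (S := {j : Fin n | (j : ℕ) < k + 1})
        (Nat.lt_succ_self k.val))).stronglyMeasurable)

lemma stronglyMeasurable_weightedDiffCondVar (hv : ∀ j, Measurable (v j))
    (hb : ∀ l l' k j, k ≤ j → b l l' k j = 0) :
    StronglyMeasurable[pastFiltration hv k] (weightedDiffCondVar μ s b v k) :=
  Finset.stronglyMeasurable_fun_sum _ fun l _ =>
    (measurable_weight hb l).stronglyMeasurable.mul <|
      Finset.stronglyMeasurable_fun_sum _ fun l' _ =>
        (measurable_weight hb l').stronglyMeasurable.const_mul _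

variable [IsProbabilityMeasure μ]

lemma isMartingaleDifference_extend_weightedDiff (h : IsCenteredIndep μ v κ)
    (hb : ∀ l l' k j, k ≤ j → b l l' k j = 0) :
    IsMartingaleDifference μ (pastFiltration h.measurable)
      (Function.extend Fin.val (weightedDiff s b v) 0)
      (Function.extend Fin.val (weightedDiffCondVar μ s b v) 0) := by
  have extend_cases (N : ℕ) : (∃ k : Fin n, (k : ℕ) = N ∧
      Function.extend Fin.val (weightedDiff s b v) 0 N = weightedDiff s b v k ∧
      Function.extend Fin.val (weightedDiffCondVar μ s b v) 0 N = weightedDiffCondVar μ s b v k) ∨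
      Function.extend Fin.val (weightedDiff s b v) 0 N = 0 ∧
      Function.extend Fin.val (weightedDiffCondVar μ s b v) 0 N = 0 := by
    by_cases hN : ∃ k : Fin n, (k : ℕ) = N
    · obtain ⟨k, rfl⟩ := hN
      exact .inl ⟨k, rfl, Fin.val_injective.extend_apply _ _ k,
        Fin.val_injective.extend_apply _ _ k⟩
    · exact .inr ⟨Function.extend_apply' _ _ _ hN, Function.extend_apply' _ _ _ hN⟩
  constructor <;> intro N <;>
    rcases extend_cases N with ⟨k, rfl, diff_eq, condVar_eq⟩ | ⟨diff_eq, condVar_eq⟩ <;>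
    simp only [diff_eq, condVar_eq]
  · exact stronglyMeasurable_weightedDiff h.measurable hb
  · exact stronglyMeasurable_zero
  · exact stronglyMeasurable_weightedDiffCondVar h.measurable hb
  · exact stronglyMeasurable_zero
  · exact memLp_four_weightedDiff h hb
  · exact MemLp.zero
  · exact fun ω => dotProduct_secondMoment_mulVec_self_nonneg (h.memLp_two k) _
  · exact fun _ => le_rfl
  · exact condExp_weightedDiff h hb
  · exact condExp_zero.eventuallyEq
  · exact condExp_weightedDiff_sq h hb
  · simp only [Pi.zero_apply, zero_pow two_ne_zero]
    exact condExp_zero.eventuallyEq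

lemma variance_sum_weightedDiff (h : IsCenteredIndep μ v κ)
    (hb : ∀ l l' k j, k ≤ j → b l l' k j = 0) :
    Var[fun ω => ∑ k, weightedDiff s b v k ω; μ] =
      ∫ ω, ∑ k, weightedDiffCondVar μ s b v k ω ∂μ := by
  simpa only [sum_range_extend_val] using
    (isMartingaleDifference_extend_weightedDiff h hb).variance_sum_eq n

lemma integral_abs_mul_sum_weightedDiffCondVar_sub_one_le (h : IsCenteredIndep μ v κ)
    (hγ0 : 0 ≤ γ) (hγ : ∀ l l', ‖b l l' * (b l l')ᵀ‖ ≤ γ) {a C : ℝ} (ha0 : 0 ≤ a) (haC : a ≤ C)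
    (ha : a * ∫ ω, ∑ k, weightedDiffCondVar μ s b v k ω ∂μ = 1) :
    ∫ ω, |a * ∑ k, weightedDiffCondVar μ s b v k ω - 1| ∂μ ≤
      √(8 * (Fintype.card δ ^ 4 * (κ ^ 2 * γ * C) +
        Fintype.card δ ^ 8 * (κ ^ 4 * γ ^ 2 * C ^ 2))) := by
  have abs_le := integral_abs_mul_sub_mul_integral_le
    (memLp_two_sum_weightedDiffCondVar (s := s) (b := b) h) ha0
  rw [ha] at abs_le
  refine abs_le.trans (Real.le_sqrt_of_sq_le ?_)
  rw [mul_pow, Real.sq_sqrt (variance_nonneg _ _)]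
  refine (mul_le_mul_of_nonneg_left (variance_sum_weightedDiffCondVar_le h hγ0 hγ)
    (sq_nonneg a)).trans ?_
  calc _ = 8 * (Fintype.card δ ^ 4 *
          (κ ^ 2 * γ * (a * (a * ∫ ω, ∑ k, weightedDiffCondVar μ s b v k ω ∂μ))) +
        Fintype.card δ ^ 8 * (κ ^ 4 * γ ^ 2 * a ^ 2)) := by ring
    _ ≤ _ := by rw [ha, mul_one]; gcongr

end CentralLimit

section Array

variable {δ : Type*} [Fintype δ] {Ω : ℕ → Type*} {m : ∀ n, MeasurableSpace (Ω n)}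
  {μ : ∀ n, Measure (Ω n)} [∀ n, IsProbabilityMeasure (μ n)] {r : ℕ → ℕ}
  {v : ∀ n, Fin (r n) → Ω n → δ → ℝ} {s : ∀ n, Fin (r n) → δ → ℝ} {κ C : ℝ} {c γ : ℕ → ℝ}
  {b : ∀ n, δ → δ → Matrix (Fin (r n)) (Fin (r n)) ℝ}

lemma tendsto_integral_abs_sum_weightedDiffCondVar_sub_one
    (h : ∀ n, IsCenteredIndep (μ n) (v n) κ) (hb : ∀ n l l' k j, k ≤ j → b n l l' k j = 0)
    (hc : ∀ᶠ n in atTop, |c n| ≤ C)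
    (hvar : ∀ᶠ n in atTop,
      c n ^ 2 * Var[fun ω => ∑ k, weightedDiff (s n) (b n) (v n) k ω; μ n] = 1)
    (hγ0 : ∀ n, 0 ≤ γ n) (hγ : ∀ n l l', ‖b n l l' * (b n l l')ᵀ‖ ≤ γ n)
    (hγ_tendsto : Tendsto γ atTop (𝓝 0)) :
    Tendsto (fun n => ∫ ω, |c n ^ 2 * ∑ k, weightedDiffCondVar (μ n) (s n) (b n) (v n) k ω - 1|
      ∂(μ n)) atTop (𝓝 0) := by
  have bound_tendsto : Tendsto (fun n => √(8 * (Fintype.card δ ^ 4 * (κ ^ 2 * γ n * C ^ 2) +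
      Fintype.card δ ^ 8 * (κ ^ 4 * γ n ^ 2 * (C ^ 2) ^ 2)))) atTop (𝓝 0) := by
    simpa using (((((hγ_tendsto.const_mul (κ ^ 2)).mul_const (C ^ 2)).const_mul
      ((Fintype.card δ : ℝ) ^ 4)).add ((((hγ_tendsto.pow 2).const_mul (κ ^ 4)).mul_const
        ((C ^ 2) ^ 2)).const_mul ((Fintype.card δ : ℝ) ^ 8))).const_mul 8).sqrt
  refine squeeze_zero' (.of_forall fun n => by positivity) ?_ bound_tendsto
  filter_upwards [hc, hvar] with n hcn hvar_n
  rw [variance_sum_weightedDiff (h n) (hb n)] at hvar_n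
  exact integral_abs_mul_sum_weightedDiffCondVar_sub_one_le (h n) (hγ0 n) (hγ n) (sq_nonneg _)
    (sq_le_sq' (neg_le_of_abs_le hcn) (le_of_abs_le hcn)) hvar_n

lemma tendsto_sum_integral_mul_weightedDiff_pow_four (h : ∀ n, IsCenteredIndep (μ n) (v n) κ)
    (hb : ∀ n l l' k j, k ≤ j → b n l l' k j = 0) (hc : ∀ᶠ n in atTop, |c n| ≤ C)
    (hs : ∀ l, Tendsto (fun n => ∑ k, s n k l ^ 4) atTop (𝓝 0))
    (hγ : ∀ n l l', ‖b n l l' * (b n l l')ᵀ‖ ≤ γ n) (hγ_tendsto : Tendsto γ atTop (𝓝 0)) :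
    Tendsto (fun n => ∑ k, ∫ ω, (c n * weightedDiff (s n) (b n) (v n) k ω) ^ 4 ∂(μ n)) atTop
      (𝓝 0) := by
  have bound_tendsto : Tendsto (fun n => C ^ 4 * (8 * Fintype.card δ ^ 3 * κ ^ 2 *
      (∑ l, ∑ k, s n k l ^ 4 + 3 * Fintype.card δ ^ 5 * κ ^ 2 * γ n ^ 2))) atTop (𝓝 0) := by
    simpa using (((tendsto_finsetSum Finset.univ fun l _ => hs l).add
      ((hγ_tendsto.pow 2).const_mul (3 * Fintype.card δ ^ 5 * κ ^ 2))).const_mul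
        (8 * Fintype.card δ ^ 3 * κ ^ 2)).const_mul (C ^ 4)
  refine squeeze_zero' (.of_forall fun n => Finset.sum_nonneg fun k _ => by positivity) ?_
    bound_tendsto
  filter_upwards [hc] with n hcn
  simp only [mul_pow, integral_const_mul, ← Finset.mul_sum]
  have pow_four_le : c n ^ 4 ≤ C ^ 4 := by
    simpa only [Even.pow_abs ⟨2, rfl⟩] using pow_le_pow_left₀ (abs_nonneg _) hcn 4
  exact mul_le_mul pow_four_le (sum_integral_weightedDiff_pow_four_le (h n) (hb n) (hγ n))
    (Finset.sum_nonneg fun k _ => by positivity) (by positivity)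

theorem tendstoInDistribution_sum_weightedDiff (h : ∀ n, IsCenteredIndep (μ n) (v n) κ)
    (hb : ∀ n l l' k j, k ≤ j → b n l l' k j = 0) (hc : ∀ᶠ n in atTop, |c n| ≤ C)
    (hvar : ∀ᶠ n in atTop,
      c n ^ 2 * Var[fun ω => ∑ k, weightedDiff (s n) (b n) (v n) k ω; μ n] = 1)
    (hs : ∀ l, Tendsto (fun n => ∑ k, s n k l ^ 4) atTop (𝓝 0))
    (hγ0 : ∀ n, 0 ≤ γ n) (hγ : ∀ n l l', ‖b n l l' * (b n l l')ᵀ‖ ≤ γ n)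
    (hγ_tendsto : Tendsto γ atTop (𝓝 0)) :
    TendstoInDistribution (fun n ω => c n * ∑ k, weightedDiff (s n) (b n) (v n) k ω) atTop
      (id : ℝ → ℝ) μ (gaussianReal 0 1) := by
  have condVar_tendsto :=
    tendsto_integral_abs_sum_weightedDiffCondVar_sub_one h hb hc hvar hγ0 hγ hγ_tendsto
  have pow_four_tendsto :=
    tendsto_sum_integral_mul_weightedDiff_pow_four h hb hc hs hγ hγ_tendsto
  have clt := tendstoInDistribution_sum_gaussianReal_of_tendsto_condVar
    (fun n => (isMartingaleDifference_extend_weightedDiff (s := s n) (h n) (hb n)).const_mul (c n))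
    r 1
    (by simpa only [← Finset.mul_sum, sum_range_extend_val, NNReal.coe_one] using condVar_tendsto)
    (by simpa only [← Fin.sum_univ_eq_sum_range, Fin.val_injective.extend_apply]
      using! pow_four_tendsto)
  simpa only [← Finset.mul_sum, sum_range_extend_val] using clt

end Array

section LowerCoeff

variable {n d : ℕ} (G : Matrix (Fin n) (Fin n) ℝ) (A : Matrix (Fin d) (Fin d) ℝ)

/-- The coefficients of `quadraticStat s G A v` once the larger index of each pair is put first: the
coefficient of `v k l * v j l'` with `j < k`. -/
def lowerCoeff (l l' : Fin d) : Matrix (Fin n) (Fin n) ℝ :=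
  A l l' • strictLower G + A l' l • (strictUpper G)ᵀ

lemma lowerCoeff_eq_zero (l l' : Fin d) (k j : Fin n) (h : k ≤ j) :
    lowerCoeff G A l l' k j = 0 := by
  simp [lowerCoeff, strictLower, strictUpper, not_lt.2 h]

lemma frobenius_norm_lowerCoeff_gram_le {a : ℝ} (hA : ∀ l l', |A l l'| ≤ a) (l l' : Fin d) :
    ‖lowerCoeff G A l l' * (lowerCoeff G A l l')ᵀ‖ ≤ 2 * a ^ 2 *
      (‖strictLower G * (strictLower G)ᵀ‖ + ‖strictUpper G * (strictUpper G)ᵀ‖) := by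
  have sq_le (l l' : Fin d) : A l l' ^ 2 ≤ a ^ 2 :=
    sq_le_sq' (neg_le_of_abs_le (hA l l')) (le_of_abs_le (hA l l'))
  refine (frobenius_norm_gram_add_le _ _).trans ?_
  rw [frobenius_norm_gram_smul, frobenius_norm_gram_smul, Matrix.transpose_transpose,
    frobenius_norm_gram_transpose, mul_assoc, mul_add (a ^ 2)]
  exact mul_le_mul_of_nonneg_left (add_le_add
    (mul_le_mul_of_nonneg_right (sq_le l l') (norm_nonneg _))
    (mul_le_mul_of_nonneg_right (sq_le l' l) (norm_nonneg _))) zero_le_two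

lemma sum_filter_ne_mul (f : Fin n → Fin n → ℝ) :
    ∑ i, ∑ j ∈ Finset.univ.filter (fun j => j ≠ i), G i j * f i j =
      ∑ i, ∑ j, (strictLower G i j * f i j + (strictUpper G)ᵀ i j * f j i) := by
  have split (i j : Fin n) : (if j ≠ i then G i j * f i j else 0) =
      strictLower G i j * f i j + strictUpper G i j * f i j := by
    rcases lt_trichotomy i j with hij | rfl | hij
    · simp [strictLower, strictUpper, hij, hij.ne', not_lt.2 hij.le]
    · simp [strictLower, strictUpper]
    · simp [strictLower, strictUpper, hij, hij.ne, not_lt.2 hij.le]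
  simp only [Finset.sum_filter, split, Finset.sum_add_distrib, Matrix.transpose_apply]
  exact congrArg _ Finset.sum_comm

lemma linearWeight_lowerCoeff_dotProduct {Ω : Type*} (v : Fin n → Ω → Fin d → ℝ) (k : Fin n)
    (ω : Ω) : linearWeight (lowerCoeff G A) v k ω ⬝ᵥ v k ω =
      ∑ j, (strictLower G k j * (v k ω ⬝ᵥ A *ᵥ v j ω) +
        (strictUpper G)ᵀ k j * (v j ω ⬝ᵥ A *ᵥ v k ω)) := by
  have transpose_eq (j : Fin n) : v j ω ⬝ᵥ A *ᵥ v k ω = v k ω ⬝ᵥ Aᵀ *ᵥ v j ω := by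
    rw [Matrix.dotProduct_mulVec, dotProduct_comm, Matrix.mulVec_transpose]
  simp only [transpose_eq]
  simp only [linearWeight, lowerCoeff, dotProduct, Matrix.mulVec, Finset.sum_mul,
    Finset.mul_sum, ← Finset.sum_add_distrib, Matrix.add_apply, Matrix.smul_apply, smul_eq_mul,
    Matrix.transpose_apply]
  rw [Finset.sum_comm (s := (Finset.univ : Finset (Fin n)))]
  refine Finset.sum_congr rfl fun l _ => ?_
  rw [Finset.sum_comm (s := (Finset.univ : Finset (Fin n)))]
  exact Finset.sum_congr rfl fun l' _ => Finset.sum_congr rfl fun j _ => by ring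

lemma quadraticStat_eq_sum_weightedDiff {Ω : Type*} (s : Fin n → Fin d → ℝ)
    (v : Fin n → Ω → Fin d → ℝ) :
    quadraticStat s G A v = fun ω => ∑ k, weightedDiff s (lowerCoeff G A) v k ω := by
  ext ω
  simp only [quadraticStat, weightedDiff, add_dotProduct, Finset.sum_add_distrib,
    sum_filter_ne_mul G fun i j => v i ω ⬝ᵥ A *ᵥ v j ω, linearWeight_lowerCoeff_dotProduct]

end LowerCoeff

theorem lemma2
    {d : ℕ} {Ω : ℕ → Type*} [∀ n, MeasurableSpace (Ω n)]
    (μ : ∀ n, Measure (Ω n)) [∀ n, IsProbabilityMeasure (μ n)]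
    (v : ∀ n, Fin n → Ω n → Fin d → ℝ)
    (s : ∀ n, Fin n → Fin d → ℝ)
    (G : ∀ n, Matrix (Fin n) (Fin n) ℝ)
    (A : ℕ → Matrix (Fin d) (Fin d) ℝ)
    (hA : ∃ C : ℝ, ∀ n, ∀ k l, |A n k l| ≤ C)
    (hmeas : ∀ n i, Measurable (v n i))
    (hindep : ∀ n, iIndepFun (v n) (μ n))
    (hmean : ∀ n i l, ∫ ω, v n i ω l ∂(μ n) = 0)
    (hmoment : ∃ C : ℝ, ∀ n i l,
      Integrable (fun ω => v n i ω l ^ 4) (μ n) ∧ ∫ ω, v n i ω l ^ 4 ∂(μ n) ≤ C)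
    (hvar : ∃ C : ℝ, ∀ᶠ n in atTop,
      0 < Var[quadraticStat (s n) (G n) (A n) (v n); μ n] ∧
        Var[quadraticStat (s n) (G n) (A n) (v n); μ n] ^ (-(1 / 2) : ℝ) ≤ C)
    (hs : ∀ l, Tendsto (fun n => ∑ i, s n i l ^ 4) atTop (𝓝 0))
    (hG : Tendsto (fun n =>
      ‖strictLower (G n) * (strictLower (G n))ᵀ‖ + ‖strictUpper (G n) * (strictUpper (G n))ᵀ‖)
      atTop (𝓝 0)) :
    TendstoInDistribution
      (fun n ω => Var[quadraticStat (s n) (G n) (A n) (v n); μ n] ^ (-(1 / 2) : ℝ) *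
        quadraticStat (s n) (G n) (A n) (v n) ω)
      atTop (id : ℝ → ℝ) μ (gaussianReal 0 1) := by
  obtain ⟨CA, hA⟩ := hA
  obtain ⟨Cm, hmoment⟩ := hmoment
  obtain ⟨Cv, hvar⟩ := hvar
  have centered (n : ℕ) : IsCenteredIndep (μ n) (v n) (max Cm 1) :=
    { measurable := hmeas n
      indep := hindep n
      nonneg := by positivity
      memLp_four := fun k l => (memLp_four_iff_integrable_pow
        ((measurable_pi_apply l).comp (hmeas n k)).aestronglyMeasurable).2 (hmoment n k l).1
      integral_eq_zero := hmean n
      integral_pow_four_le := fun k l => (hmoment n k l).2.trans <| (le_max_left _ _).trans <|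
        le_self_pow₀ (le_max_right _ _) two_ne_zero }
  have rpow_sq_mul_variance : ∀ᶠ n in atTop,
      (Var[quadraticStat (s n) (G n) (A n) (v n); μ n] ^ (-(1 / 2) : ℝ)) ^ 2 *
        Var[quadraticStat (s n) (G n) (A n) (v n); μ n] = 1 := hvar.mono fun n hn => by
    rw [← Real.rpow_natCast, ← Real.rpow_mul hn.1.le, ← Real.rpow_add_one hn.1.ne']
    norm_num
  have rpow_le := hvar.mono fun n hn => (abs_of_nonneg (Real.rpow_nonneg hn.1.le _)).trans_le hn.2
  simp only [quadraticStat_eq_sum_weightedDiff] at rpow_sq_mul_variance rpow_le ⊢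
  exact tendstoInDistribution_sum_weightedDiff centered
    (fun n => lowerCoeff_eq_zero (G n) (A n)) rpow_le rpow_sq_mul_variance hs
    (fun n => by positivity) (fun n => frobenius_norm_lowerCoeff_gram_le (G n) (A n) (hA n))
    (by simpa using hG.const_mul (2 * CA ^ 2))
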